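/- Let $k$ be an algebraically closed field and let $V$ be a $4$-dimensional $k$-vector space. For a $6$-dimensional subspace $R\subseteq V\otimes V$ put $$S_R=\{W\in G(8,V\otimes V)\mid W\cap R\neq 0\},\qquad X_R=S_R\cap G(2,V),$$ where $G(d,E)$ denotes the Grassmannian of $d$-dimensional subspaces of $E$ with its Zariski topology (induced from projective space by the Plücker embedding), and $G(2,V)$ is embedded in $G(8,V\otimes V)$ by $Q\mapsto Q\otimes V$; thus the points of $X_R$ are the $Q\in G(2,V)$ with $(Q\otimes V)\cap R\neq 0$. Then the set $$U=\{R\in G(6,V\otimes V)\mid \dim X_R=1\}$$ is a dense open subset of $G(6,V\otimes V)$. -/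

import Mathlib

open scoped TensorProduct LinearAlgebra.Projectivization

namespace LineLocus

section Zariski

variable (k : Type*) [Field k] (E : Type*) [AddCommGroup E] [Module k E]

/-- The common zeros in `ℙ(E)` of a set `T` of polynomials in linear forms on `E`
(used only for sets of homogeneous polynomials, where the choice of representative is immaterial). -/
def projZeroLocus (T : Set (MvPolynomial (Module.Dual k E) k)) : Set (ℙ k E) :=
  {x | ∀ p ∈ T, MvPolynomial.eval (fun l : Module.Dual k E => l x.rep) p = 0}

/-- The Zariski topology on (the closed points of) the projective space of lines in `E`: the closed
sets are the zero loci of sets of homogeneous polynomials. -/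
abbrev projZariski : TopologicalSpace (ℙ k E) :=
  TopologicalSpace.ofClosed
    {Z | ∃ T : Set (MvPolynomial (Module.Dual k E) k),
      (∀ p ∈ T, ∃ n : ℕ, p.IsHomogeneous n) ∧ Z = projZeroLocus k E T}
    (by
      refine ⟨{1}, ?_, ?_⟩
      · intro p hp
        rw [Set.mem_singleton_iff] at hp
        exact ⟨0, hp ▸ MvPolynomial.isHomogeneous_one _ _⟩
      · ext x
        simp [projZeroLocus])
    (by
      intro A hA
      refine ⟨{p | (∃ n : ℕ, p.IsHomogeneous n) ∧
        ∃ T : Set (MvPolynomial (Module.Dual k E) k), (∀ q ∈ T, ∃ n : ℕ, q.IsHomogeneous n) ∧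
          projZeroLocus k E T ∈ A ∧ p ∈ T}, fun p hp => hp.1, ?_⟩
      ext x
      simp only [Set.mem_sInter]
      constructor
      · rintro h p ⟨-, T, -, hTA, hpT⟩
        exact h _ hTA p hpT
      · intro h Z hZ
        obtain ⟨T, hT, rfl⟩ := hA hZ
        exact fun p hp => h p ⟨hT p hp, T, hT, hZ, hp⟩)
    (by
      rintro _ ⟨T₁, h₁, rfl⟩ _ ⟨T₂, h₂, rfl⟩
      refine ⟨{r | ∃ p ∈ T₁, ∃ q ∈ T₂, r = p * q}, ?_, ?_⟩
      · rintro _ ⟨p, hp, q, hq, rfl⟩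
        obtain ⟨m, hm⟩ := h₁ p hp
        obtain ⟨n, hn⟩ := h₂ q hq
        exact ⟨m + n, hm.mul hn⟩
      · ext x
        constructor
        · rintro (h | h) _ ⟨p, hp, q, hq, rfl⟩
          · rw [map_mul, h p hp, zero_mul]
          · rw [map_mul, h q hq, mul_zero]
        · intro h
          by_contra hx
          simp only [Set.mem_union, not_or, projZeroLocus, Set.mem_ofPred_eq, not_forall] at hx
          obtain ⟨⟨p, hp, hp0⟩, ⟨q, hq, hq0⟩⟩ := hx
          have := h _ ⟨p, hp, q, hq, rfl⟩
          rw [map_mul] at this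
          exact (mul_ne_zero hp0 hq0) this)

end Zariski

section Grassmannian

variable (k : Type*) [Field k] (d : ℕ) (E : Type*) [AddCommGroup E] [Module k E]

/-- The Grassmannian `G(d, E)` of `d`-dimensional linear subspaces of `E`. -/
def Gr : Type _ := {W : Submodule k E // Module.finrank k W = d}

variable [FiniteDimensional k E]

/-- The Plücker map `G(d, E) → ℙ(⋀ᵈ E)`, sending `W` to the line `⋀ᵈ W ⊆ ⋀ᵈ E`. -/
noncomputable def plucker (W : Gr k d E) : ℙ k (⋀[k]^d E) :=
  Projectivization.mk'' (LinearMap.range (exteriorPower.map d W.1.subtype)) (by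
    rw [LinearMap.finrank_range_of_inj (exteriorPower.map_injective_field (by simp)),
      exteriorPower.finrank_eq, W.2, Nat.choose_self])

/-- The Zariski topology on `G(d, E)`, induced by the Plücker map. -/
noncomputable instance Gr.zariski : TopologicalSpace (Gr k d E) :=
  TopologicalSpace.induced (plucker k d E) (projZariski k (⋀[k]^d E))

end Grassmannian

section Locus

variable {k : Type*} [Field k] {V : Type*} [AddCommGroup V] [Module k V] [FiniteDimensional k V]

/-- The map `G(2, V) → G(8, V ⊗ V)`, `Q ↦ Q ⊗ V`, for `dim V = 4`. -/
noncomputable def tensorRight (hV : Module.finrank k V = 4) (Q : Gr k 2 V) :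
    Gr k 8 (V ⊗[k] V) :=
  ⟨LinearMap.range (LinearMap.rTensor V Q.1.subtype), by
    rw [LinearMap.finrank_range_of_inj
        (Module.Flat.rTensor_preserves_injective_linearMap _ Q.1.injective_subtype),
      Module.finrank_tensorProduct, Q.2, hV]⟩

/-- The special Schubert variety `S_R = {W ∈ G(8, V ⊗ V) | W ∩ R ≠ 0}`. -/
def schubert (R : Gr k 6 (V ⊗[k] V)) : Set (Gr k 8 (V ⊗[k] V)) :=
  {W | W.1 ⊓ R.1 ≠ ⊥}

/-- `X_R = S_R ∩ G(2, V)`, where `G(2, V)` is mapped to `G(8, V ⊗ V)` by `Q ↦ Q ⊗ V`;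
it is the set of (closed) points of the scheme-theoretic intersection. -/
def lineLocus (hV : Module.finrank k V = 4) (R : Gr k 6 (V ⊗[k] V)) : Set (Gr k 2 V) :=
  tensorRight hV ⁻¹' schubert R

/-- `U = {R ∈ G(6, V ⊗ V) | dim X_R = 1}`; the dimension is the Krull dimension of the
underlying topological space. -/
def dimOneLocus (hV : Module.finrank k V = 4) : Set (Gr k 6 (V ⊗[k] V)) :=
  {R | topologicalKrullDim (lineLocus hV R) = 1}

end Locus

end LineLocus

/-!
Write `dim X_R` for the Krull dimension of `X_R`. The proof bounds dimensions by linear sections of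
`G(2, V) ⊆ ℙ(⋀² V)` throughout.

*Dimension and linear sections.* For a closed subset `X` of a projective space, `dim X < n` iff some
linear subspace of codimension `n` misses `X`. One direction chooses hyperplanes containing no
irreducible component (`IsProjCoord.exists_forall_exists_dotProduct_ne_zero`). For the other, if
linear forms `l₁, …, lₙ` have no common zero on `X`, then the homogeneous coordinate ring of `X` is
integral over `k[l₁, …, lₙ]` (`isIntegral_comp_aeval_of_forall_eq_zero`), and a chain of irreducible
closed subsets of `X`, completed by the irrelevant ideal, gives a chain of primes in it
(`IsProjCoord.topologicalKrullDim_lt`). This applies to `X_R`, because the cone over `X_R` is closed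
(`exists_eq_smul_coords`).

*`dim X_R ≥ 1` for all `R`.* A hyperplane section of `G(2, V)` consists of the planes isotropic for
an alternating form on `V`. The tensors lying in `Q ⊗ V` for an isotropic plane `Q` form a cone
whose coordinate ring has transcendence degree `11`, since it is parametrized by
`u ⊗ a + w ⊗ b` with `a, b ∈ V` and `(u, w)` in a three-dimensional family. The ten linear equations
of `R` therefore have a nonzero solution on it (`exists_isotropic_mem_lineLocus`). Hence no
hyperplane misses `X_R`.

*Openness.* It follows that `dim X_R = 1` iff some linear section of codimension two misses `X_R`.
For a fixed section this says that `R` meets a fixed cone of tensors only in `0`: the cone of the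
tensors of rank at most two on whose columns two given alternating forms vanish
(`exists_mem_lineLocus_iff`). This is an open condition on `R` by elimination theory
(`isClosed_setOf_exists_mem_cone`).

*Density.* The Grassmannian is irreducible (`Gr.preirreducibleSpace`), so one `R` with `dim X_R = 1`
suffices. For the space of band tensors, `X_R` misses the quadric surface of the planes meeting two
fixed complementary planes (`nonempty_dimOneLocus`).
-/

namespace LineLocus

/-! ### Cones and graded Noether normalization -/

section Cones

open MvPolynomial

variable {k : Type*} [Field k] {σ : Type*}

theorem eval_smul_of_isHomogeneous {p : MvPolynomial σ k} {n : ℕ} (hp : p.IsHomogeneous n)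
    (t : k) (x : σ → k) : eval (t • x) p = t ^ n * eval x p := by
  rw [eval_eq, eval_eq, Finset.mul_sum]
  refine Finset.sum_congr rfl fun d hd => ?_
  have h : ∑ i ∈ d.support, d i = n := (hp.degree_eq_sum_deg_support hd).symm
  simp only [Pi.smul_apply, smul_eq_mul, mul_pow, Finset.prod_mul_distrib,
    Finset.prod_pow_eq_pow_sum, h]
  ring

theorem eval_smul_eq_sum (p : MvPolynomial σ k) (t : k) (x : σ → k) :
    eval (t • x) p =
      ∑ n ∈ Finset.range (p.totalDegree + 1), t ^ n * eval x (homogeneousComponent n p) := by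
  conv_lhs => rw [← sum_homogeneousComponent p, map_sum]
  exact Finset.sum_congr rfl fun n _ =>
    eval_smul_of_isHomogeneous (homogeneousComponent_isHomogeneous n p) t x

/-- The restriction of a polynomial to the line through `0` and `x`. -/
noncomputable def linePoly (p : MvPolynomial σ k) (x : σ → k) : Polynomial k :=
  ∑ n ∈ Finset.range (p.totalDegree + 1),
    Polynomial.monomial n (eval x (homogeneousComponent n p))

theorem eval_linePoly (p : MvPolynomial σ k) (t : k) (x : σ → k) :
    (linePoly p x).eval t = eval (t • x) p := by
  rw [eval_smul_eq_sum, linePoly, Polynomial.eval_finsetSum]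
  simp [mul_comm]

theorem coeff_linePoly (p : MvPolynomial σ k) (x : σ → k) (n : ℕ) :
    (linePoly p x).coeff n = eval x (homogeneousComponent n p) := by
  rw [linePoly, Polynomial.finsetSum_coeff]
  simp only [Polynomial.coeff_monomial, Finset.sum_ite_eq', Finset.mem_range]
  split_ifs with h
  · rfl
  · rw [homogeneousComponent_eq_zero _ _ (by omega), map_zero]

/-- A polynomial vanishes on a line through `0` iff its homogeneous components do. -/
theorem forall_eval_smul_eq_zero_iff [Infinite k] (p : MvPolynomial σ k) (x : σ → k) :
    (∀ t : k, eval (t • x) p = 0) ↔ ∀ n, eval x (homogeneousComponent n p) = 0 := by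
  constructor
  · intro h n
    have : linePoly p x = 0 := Polynomial.funext fun t => by
      rw [eval_linePoly, h, Polynomial.eval_zero]
    rw [← coeff_linePoly, this, Polynomial.coeff_zero]
  · intro h t
    rw [eval_smul_eq_sum]
    exact Finset.sum_eq_zero fun n _ => by rw [h, mul_zero]

theorem homogeneousComponent_add_mul {l : MvPolynomial σ k} {m : ℕ} (hl : l.IsHomogeneous m)
    (g : MvPolynomial σ k) (d : ℕ) :
    homogeneousComponent (d + m) (l * g) = l * homogeneousComponent d g := by
  conv_lhs => rw [← sum_homogeneousComponent g, Finset.mul_sum, map_sum]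
  have (i : ℕ) : homogeneousComponent (d + m) (l * homogeneousComponent i g)
      = if d = i then l * homogeneousComponent i g else 0 := by
    rw [homogeneousComponent_of_mem (hl.mul (homogeneousComponent_isHomogeneous i g))]
    congr 1
    simp only [eq_iff_iff]; omega
  simp only [this, Finset.sum_ite_eq, Finset.mem_range]
  split_ifs with h
  · rfl
  · rw [homogeneousComponent_eq_zero _ _ (by omega), mul_zero]

/-- The projective Nullstellensatz: an ideal without nonzero zeros contains all forms of large
degree. -/
theorem exists_forall_isHomogeneous_mem [IsAlgClosed k] [Finite σ] {J : Ideal (MvPolynomial σ k)}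
    (h : ∀ x : σ → k, (∀ p ∈ J, eval x p = 0) → x = 0) :
    ∃ N : ℕ, ∀ n, N ≤ n → ∀ p : MvPolynomial σ k, p.IsHomogeneous n → p ∈ J := by
  have hle : idealOfVars σ k ≤ J.radical := by
    rw [← vanishingIdeal_zeroLocus_eq_radical (K := k), idealOfVars, Ideal.span_le]
    rintro _ ⟨i, rfl⟩ x hx
    have hx0 : x = 0 := h x fun p hp => by simpa [aeval_eq_eval] using hx p hp
    simp [hx0]
  obtain ⟨N, hN⟩ := Ideal.exists_pow_le_of_le_radical_of_fg hle (idealOfVars_fg σ k)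
  refine ⟨N, fun n hn p hp => hN ?_⟩
  rw [mem_pow_idealOfVars_iff]
  intro d hd
  rw [hp.degree_eq_sum_deg_support hd] at hn
  exact hn

/-- Graded Noether normalization: if linear forms `l i` have no nonzero common zero on the cone of
a homogeneous ideal `ker π`, the coordinate ring `B` of the cone is integral over the ring generated
by the `l i`. -/
theorem isIntegral_comp_aeval_of_forall_eq_zero [IsAlgClosed k] [Finite σ] {B : Type*} [CommRing B]
    {π : MvPolynomial σ k →+* B} (hπ : Function.Surjective π)
    (hI : ∀ p, π p = 0 → ∀ n, π (homogeneousComponent n p) = 0)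
    {ι : Type*} [Finite ι] (l : ι → MvPolynomial σ k) (hl : ∀ i, (l i).IsHomogeneous 1)
    (h : ∀ x : σ → k, (∀ p, π p = 0 → eval x p = 0) → (∀ i, eval x (l i) = 0) → x = 0) :
    (π.comp
      (aeval l : MvPolynomial ι k →ₐ[k] MvPolynomial σ k).toRingHom).IsIntegral := by
  cases nonempty_fintype ι
  let φ := π.comp (aeval l : MvPolynomial ι k →ₐ[k] MvPolynomial σ k).toRingHom
  obtain ⟨N, hN⟩ := exists_forall_isHomogeneous_mem
    (J := RingHom.ker π ⊔ Ideal.span (Set.range l)) (by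
    intro x hx
    refine h x (fun p hp => hx p (Ideal.mem_sup_left hp)) fun i => hx _ (Ideal.mem_sup_right ?_)
    exact Ideal.subset_span ⟨i, rfl⟩)
  let _ := φ.toAlgebra
  have smul_def' (a : MvPolynomial ι k) (p : MvPolynomial σ k) :
      a • π p = π (aeval l a * p) := by
    rw [Algebra.smul_def, map_mul]; rfl
  let mons : Set (σ →₀ ℕ) := {d | d.degree < N}
  have hmons : mons.Finite := by
    refine Set.Finite.subset (Finsupp.finite_of_degree_le (σ := σ) N) ?_
    intro d hd
    exact Nat.le_of_lt hd
  let M : Submodule (MvPolynomial ι k) (B) :=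
    Submodule.span _ ((fun d => π (monomial d 1)) '' mons)
  have key (d : ℕ) : ∀ p : MvPolynomial σ k, p.IsHomogeneous d → π p ∈ M := by
    induction d using Nat.strong_induction_on with
    | _ d ih =>
    intro p hp
    by_cases hd : d < N
    · rw [p.as_sum, map_sum]
      refine Submodule.sum_mem _ fun e he => ?_
      have : π (monomial e (coeff e p)) =
          (C (coeff e p) : MvPolynomial ι k) • π (monomial e 1) := by
        rw [smul_def', aeval_C, algebraMap_eq, C_mul_monomial, mul_one]
      rw [this]
      refine Submodule.smul_mem _ _ (Submodule.subset_span ⟨e, ?_, rfl⟩)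
      change e.degree < N
      have := hp.degree_eq_sum_deg_support he
      rw [Finsupp.degree]
      change ∑ i ∈ e.support, e i < N
      omega
    · push Not at hd
      rcases d with _ | d
      · obtain rfl : N = 0 := by omega
        -- the elements of `(l)` have no constant term, so the constants already lie in `ker π`
        obtain ⟨a, ha, b, hb, hab⟩ := Submodule.mem_sup.1 (hN 0 le_rfl p hp)
        obtain ⟨c, rfl⟩ := Ideal.mem_span_range_iff_exists_fun.1 hb
        have h0 : homogeneousComponent 0 p = homogeneousComponent 0 a := by
          rw [← hab, map_add, map_sum]
          rw [Finset.sum_eq_zero, add_zero]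
          intro i _
          have : coeff 0 (l i) = 0 := (hl i).coeff_eq_zero (by simp)
          rw [homogeneousComponent_zero]
          rw [← constantCoeff_eq] at *
          rw [map_mul, this, mul_zero, C_0]
        rw [homogeneousComponent_eq_self hp] at h0
        have : π p = 0 := by
          rw [h0]; exact hI a ha 0
        rw [this]; exact Submodule.zero_mem _
      · obtain ⟨a, ha, b, hb, hab⟩ := Submodule.mem_sup.1 (hN (d + 1) hd p hp)
        obtain ⟨c, rfl⟩ := Ideal.mem_span_range_iff_exists_fun.1 hb
        have h0 : p = homogeneousComponent (d + 1) a +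
            ∑ i, l i * homogeneousComponent d (c i) := by
          conv_lhs => rw [← homogeneousComponent_eq_self hp, ← hab, map_add, map_sum]
          congr 1
          refine Finset.sum_congr rfl fun i _ => ?_
          rw [mul_comm, homogeneousComponent_add_mul (hl i)]
        rw [h0, map_add, hI a ha _, zero_add, map_sum]
        refine Submodule.sum_mem _ fun i _ => ?_
        have : π (l i * homogeneousComponent d (c i)) =
            (X i : MvPolynomial ι k) • π (homogeneousComponent d (c i)) := by
          rw [smul_def', aeval_X]
        rw [this]
        exact M.smul_mem _ (ih d (by omega) _ (homogeneousComponent_isHomogeneous d _))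
  have htop : M = ⊤ := by
    rw [eq_top_iff]
    rintro x -
    obtain ⟨p, rfl⟩ := hπ x
    rw [← sum_homogeneousComponent p, map_sum]
    exact Submodule.sum_mem _ fun n _ => key n _ (homogeneousComponent_isHomogeneous n p)
  have : Module.Finite (MvPolynomial ι k) (B) :=
    ⟨htop ▸ Submodule.fg_span (hmons.image _)⟩
  exact fun x => IsIntegral.of_finite (MvPolynomial ι k) x

end Cones

/-! ### Dimension of projective sets and linear sections -/

section ProjCoord

open MvPolynomial TopologicalSpace Order

variable {k : Type*} [Field k] {σ : Type*} {Y : Type*}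

/-- The ideal of polynomials vanishing on the cone over `Z`. -/
def coneIdeal (c : Y → σ → k) (Z : Set Y) : Ideal (MvPolynomial σ k) :=
  vanishingIdeal k {x : σ → k | ∃ y ∈ Z, ∃ t : k, x = t • c y}

theorem mem_coneIdeal_iff {c : Y → σ → k} {Z : Set Y} {p : MvPolynomial σ k} :
    p ∈ coneIdeal c Z ↔ ∀ y ∈ Z, ∀ t : k, eval (t • c y) p = 0 := by
  simp only [coneIdeal, mem_vanishingIdeal_iff, aeval_eq_eval]
  constructor
  · exact fun h y hy t => h _ ⟨y, hy, t, rfl⟩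
  · rintro h _ ⟨y, hy, t, rfl⟩
    exact h y hy t

theorem mem_coneIdeal_iff_homogeneousComponent [Infinite k] {c : Y → σ → k} {Z : Set Y}
    {p : MvPolynomial σ k} :
    p ∈ coneIdeal c Z ↔ ∀ y ∈ Z, ∀ n, eval (c y) (homogeneousComponent n p) = 0 := by
  rw [mem_coneIdeal_iff]
  exact forall₂_congr fun y _ => forall_eval_smul_eq_zero_iff p (c y)

theorem homogeneousComponent_mem_coneIdeal [Infinite k] {c : Y → σ → k} {Z : Set Y}
    {p : MvPolynomial σ k} (hp : p ∈ coneIdeal c Z) (n : ℕ) :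
    homogeneousComponent n p ∈ coneIdeal c Z := by
  rw [mem_coneIdeal_iff_homogeneousComponent] at hp
  rw [mem_coneIdeal_iff]
  intro y hy t
  rw [eval_smul_of_isHomogeneous (homogeneousComponent_isHomogeneous n p), hp y hy, mul_zero]

theorem mem_coneIdeal_of_isHomogeneous {c : Y → σ → k} {Z : Set Y} {p : MvPolynomial σ k} {n : ℕ}
    (hn : p.IsHomogeneous n) (hp : ∀ y ∈ Z, eval (c y) p = 0) : p ∈ coneIdeal c Z := by
  rw [mem_coneIdeal_iff]
  intro y hy t
  rw [eval_smul_of_isHomogeneous hn, hp y hy, mul_zero]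

theorem coneIdeal_anti {c : Y → σ → k} {Z W : Set Y} (h : Z ⊆ W) :
    coneIdeal c W ≤ coneIdeal c Z := fun p hp => by
  rw [mem_coneIdeal_iff] at hp ⊢
  exact fun y hy => hp y (h hy)

variable [TopologicalSpace Y]

/-- A map `c : Y → σ → k` is a system of homogeneous coordinates on the topological space `Y` if it
does not take the value `0` and the closed sets of `Y` are the common zeros of the sets of
homogeneous polynomials in `c`; that is, `c` identifies `Y` (up to identifying points with
proportional coordinates) with a subspace of the projective space of `σ → k`. -/
structure IsProjCoord (c : Y → σ → k) : Prop where
  ne_zero : ∀ y, c y ≠ 0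
  isClosed_iff : ∀ Z : Set Y, IsClosed Z ↔ ∃ T : Set (MvPolynomial σ k),
    (∀ p ∈ T, ∃ n, p.IsHomogeneous n) ∧ Z = {y | ∀ p ∈ T, eval (c y) p = 0}

theorem IsProjCoord.restrict {c : Y → σ → k} (hc : IsProjCoord c) (s : Set Y) :
    IsProjCoord (fun y : s => c y) where
  ne_zero y := hc.ne_zero y
  isClosed_iff Z := by
    rw [isClosed_induced_iff]
    constructor
    · rintro ⟨Z', hZ', rfl⟩
      obtain ⟨T, hT, rfl⟩ := (hc.isClosed_iff _).1 hZ'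
      exact ⟨T, hT, rfl⟩
    · rintro ⟨T, hT, rfl⟩
      exact ⟨_, (hc.isClosed_iff _).2 ⟨T, hT, rfl⟩, rfl⟩

namespace IsProjCoord

variable {c : Y → σ → k}

theorem mem_of_forall_coneIdeal (hc : IsProjCoord c) {Z : Set Y} (hZ : IsClosed Z) {y : Y}
    (hy : ∀ p ∈ coneIdeal c Z, eval (c y) p = 0) : y ∈ Z := by
  obtain ⟨T, hT, rfl⟩ := (hc.isClosed_iff Z).1 hZ
  intro p hp
  obtain ⟨n, hn⟩ := hT p hp
  exact hy p (mem_coneIdeal_of_isHomogeneous hn fun y hy => hy p hp)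

theorem coneIdeal_lt (hc : IsProjCoord c) {Z W : Set Y} (hZ : IsClosed Z) (h : Z ⊂ W) :
    coneIdeal c W < coneIdeal c Z := by
  refine lt_of_le_not_ge (coneIdeal_anti h.subset) fun hle => h.not_subset fun y hy => ?_
  refine hc.mem_of_forall_coneIdeal hZ fun p hp => ?_
  simpa using (mem_coneIdeal_iff.1 (hle hp)) y hy 1

theorem noetherianSpace [Finite σ] (hc : IsProjCoord c) : NoetherianSpace Y := by
  refine ((noetherianSpace_TFAE Y).out 0 1).2 ?_
  have : StrictAnti fun Z : Closeds Y => coneIdeal c (Z : Set Y) := fun Z W h =>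
    hc.coneIdeal_lt Z.isClosed (SetLike.coe_ssubset_coe.2 h)
  exact this.wellFoundedLT

/-- The cone over an irreducible set is irreducible. -/
theorem coneIdeal_isPrime [Infinite k] (hc : IsProjCoord c) {Z : Set Y} (hZ : IsIrreducible Z) :
    (coneIdeal c Z).IsPrime := by
  have hopen (p : MvPolynomial σ k) :
      IsOpen {y | ∃ n, eval (c y) (homogeneousComponent n p) ≠ 0} := by
    rw [← isClosed_compl_iff, hc.isClosed_iff]
    refine ⟨Set.range fun n => homogeneousComponent n p, ?_, ?_⟩
    · rintro _ ⟨n, rfl⟩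
      exact ⟨n, homogeneousComponent_isHomogeneous n p⟩
    · ext y; simp
  refine ⟨?_, ?_⟩
  · obtain ⟨y, hy⟩ := hZ.nonempty
    rw [Ne, Ideal.eq_top_iff_one, mem_coneIdeal_iff]
    intro h
    simpa using h y hy 1
  · intro p q hpq
    by_contra! hcon
    simp only [mem_coneIdeal_iff_homogeneousComponent, not_forall] at hcon
    obtain ⟨⟨y, hy, n, hn⟩, ⟨z, hz, m, hm⟩⟩ := hcon
    -- a point of `Z` on whose line neither `p` nor `q` vanishes identically
    obtain ⟨x, hx, ⟨i, hi⟩, ⟨j, hj⟩⟩ := hZ.isPreirreducible _ _ (hopen p) (hopen q)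
      ⟨y, hy, n, hn⟩ ⟨z, hz, m, hm⟩
    have hp : linePoly p (c x) ≠ 0 := fun h =>
      hi (by rw [← coeff_linePoly, h, Polynomial.coeff_zero])
    have hq : linePoly q (c x) ≠ 0 := fun h =>
      hj (by rw [← coeff_linePoly, h, Polynomial.coeff_zero])
    refine mul_ne_zero hp hq (Polynomial.funext fun t => ?_)
    rw [Polynomial.eval_mul, eval_linePoly, eval_linePoly, ← map_mul, Polynomial.eval_zero]
    exact mem_coneIdeal_iff.1 hpq x hx t

end IsProjCoord

/-- The linear form with coefficients `l`. -/
noncomputable def linForm [Fintype σ] (l : σ → k) : MvPolynomial σ k := ∑ j, C (l j) * X j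

theorem linForm_isHomogeneous [Fintype σ] (l : σ → k) : (linForm l).IsHomogeneous 1 :=
  IsHomogeneous.sum _ _ _ fun j _ => isHomogeneous_C_mul_X (l j) j

@[simp]
theorem eval_linForm [Fintype σ] (l x : σ → k) : eval x (linForm l) = l ⬝ᵥ x := by
  simp [linForm, dotProduct]

theorem exists_forall_dotProduct_ne_zero [Infinite k] [Fintype σ] {ι : Type*} [Finite ι]
    (x : ι → σ → k) (hx : ∀ i, x i ≠ 0) : ∃ l : σ → k, ∀ i, l ⬝ᵥ x i ≠ 0 := by
  classical
  by_contra! h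
  obtain ⟨i, hi⟩ := Subspace.exists_eq_top_of_iUnion_eq_univ
    (p := fun i => LinearMap.ker ((dotProductBilin k k).flip (x i))) (by
      rw [Set.eq_univ_iff_forall]
      intro l
      obtain ⟨i, hi⟩ := h l
      exact Set.mem_iUnion.2 ⟨i, by simpa using hi⟩)
  refine hx i (funext fun j => ?_)
  have : Pi.single j 1 ∈ LinearMap.ker ((dotProductBilin k k).flip (x i)) := by
    rw [hi]; trivial
  simpa using this

namespace IsProjCoord

theorem isClosed_linForm [Fintype σ] {c : Y → σ → k} (hc : IsProjCoord c) (l : σ → k) :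
    IsClosed {y | l ⬝ᵥ c y = 0} := by
  rw [hc.isClosed_iff]
  refine ⟨{linForm l}, ?_, ?_⟩
  · rintro _ rfl
    exact ⟨1, linForm_isHomogeneous l⟩
  · ext y; simp

/-- A projective set of dimension less than `n` is missed by some linear subspace of
codimension `n`: each hyperplane is chosen so as to contain none of the irreducible components of
the section by the previous ones. -/
theorem exists_forall_exists_dotProduct_ne_zero [Infinite k] [Fintype σ] (n : ℕ) :
    ∀ {Y : Type*} [TopologicalSpace Y] {c : Y → σ → k}, IsProjCoord c →
      topologicalKrullDim Y < n → ∃ l : Fin n → σ → k, ∀ y, ∃ i, l i ⬝ᵥ c y ≠ 0 := by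
  induction n with
  | zero =>
    intro Y _ c hc h
    refine ⟨Fin.elim0, fun y => ?_⟩
    have : Nonempty (IrreducibleCloseds Y) :=
      ⟨⟨closure {y}, isIrreducible_singleton.closure, isClosed_closure⟩⟩
    exact absurd h (not_lt.2 (krullDim_nonneg))
  | succ n ih =>
    intro Y _ c hc h
    have := hc.noetherianSpace
    have hfin : Finite (irreducibleComponents Y) := NoetherianSpace.finite_irreducibleComponents
    choose y hy using fun Z : irreducibleComponents Y => Z.2.1.nonempty
    obtain ⟨l₀, hl₀⟩ := exists_forall_dotProduct_ne_zero (fun Z => c (y Z)) fun Z => hc.ne_zero _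
    let H : Set Y := {y | l₀ ⬝ᵥ c y = 0}
    have hH : IsClosed H := hc.isClosed_linForm l₀
    have hdim : topologicalKrullDim H < n := by
      rw [topologicalKrullDim, krullDim_lt_coe_iff]
      intro q
      have hind : Topology.IsInducing ((↑) : H → Y) := .subtypeVal
      let q' := q.map _ (IrreducibleCloseds.map_strictMono_of_isInducing hind)
      obtain ⟨Z, hZ, hle⟩ := exists_mem_irreducibleComponents_subset_of_isIrreducible
        (q'.last : Set Y) q'.last.isIrreducible
      let Z' : IrreducibleCloseds Y := ⟨Z, hZ.1, isClosed_of_mem_irreducibleComponents Z hZ⟩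
      have hsub : (q'.last : Set Y) ⊆ H := by
        have : q'.last = IrreducibleCloseds.map _ hind.continuous q.last := by
          simp [q']
        rw [this]
        refine closure_minimal ?_ hH
        rintro _ ⟨z, -, rfl⟩
        exact z.2
      have hlt : q'.last < Z' := by
        refine lt_of_le_of_ne hle fun heq => hl₀ ⟨Z, hZ⟩ (hsub ?_)
        rw [heq]
        exact hy ⟨Z, hZ⟩
      have := krullDim_lt_coe_iff.1 h (q'.snoc Z' hlt)
      simpa [q'] using this
    obtain ⟨l, hl⟩ := ih (hc.restrict H) hdim
    refine ⟨Fin.cons l₀ l, fun y => ?_⟩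
    by_cases hyH : y ∈ H
    · obtain ⟨i, hi⟩ := hl ⟨y, hyH⟩
      exact ⟨i.succ, by simpa using hi⟩
    · exact ⟨0, by simpa using! hyH⟩

/-- A projective algebraic set missed by a linear subspace of codimension `n` has dimension less
than `n`: a chain of closed irreducible subsets gives, together with the irrelevant ideal, a chain
of primes in a ring that is integral over a polynomial ring in `n` variables. -/
theorem topologicalKrullDim_lt [IsAlgClosed k] [Fintype σ] {c : Y → σ → k} (hc : IsProjCoord c)
    (hcone : ∀ x : σ → k, x ≠ 0 → (∀ p ∈ coneIdeal c Set.univ, eval x p = 0) →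
      ∃ y, ∃ t : k, x = t • c y)
    {n : ℕ} (l : Fin n → σ → k) (hl : ∀ y, ∃ i, l i ⬝ᵥ c y ≠ 0) :
    topologicalKrullDim Y < n := by
  have hinf : Infinite k := IsAlgClosed.instInfinite
  set I := coneIdeal c (Set.univ : Set Y) with hI
  have hint := isIntegral_comp_aeval_of_forall_eq_zero (π := Ideal.Quotient.mk I)
    Ideal.Quotient.mk_surjective (by
      intro p hp n
      rw [Ideal.Quotient.eq_zero_iff_mem] at hp ⊢
      exact homogeneousComponent_mem_coneIdeal hp n)
    (fun i => linForm (l i)) (fun i => linForm_isHomogeneous (l i)) (by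
      intro x hx hlx
      by_contra hx0
      obtain ⟨y, t, rfl⟩ := hcone x hx0 fun p hp => hx p (Ideal.Quotient.eq_zero_iff_mem.2 hp)
      obtain ⟨i, hi⟩ := hl y
      have := hlx i
      simp only [eval_linForm, dotProduct_smul, smul_eq_mul, mul_eq_zero] at this
      rcases this with rfl | h
      · exact hx0 (zero_smul _ _)
      · exact hi h)
  set f : MvPolynomial (Fin n) k →+* MvPolynomial σ k :=
    (aeval (R := k) fun i => linForm (l i)).toRingHom with hf
  have hcomap (P Q : Ideal (MvPolynomial σ k)) (hP : P.IsPrime) (hIP : I ≤ P) (hPQ : P < Q) :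
      P.comap f < Q.comap f := by
    obtain ⟨r, hrQ, hrP⟩ := SetLike.exists_of_lt hPQ
    obtain ⟨p, hp, hpr⟩ := hint (Ideal.Quotient.mk I r)
    refine Ideal.comap_lt_comap_of_root_mem_sdiff hPQ.le ⟨hrQ, hrP⟩ (p := p) ?_ ?_
    · have : (P.comap f).IsPrime := Ideal.comap_isPrime f P
      exact (hp.map _).ne_zero
    · rw [← Polynomial.hom_eval₂, Ideal.Quotient.eq_zero_iff_mem] at hpr
      exact hIP hpr
  rw [topologicalKrullDim, krullDim_lt_coe_iff]
  intro q
  have hprime (Z : IrreducibleCloseds Y) : (coneIdeal c (Z : Set Y)).IsPrime :=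
    hc.coneIdeal_isPrime Z.isIrreducible
  let g : IrreducibleCloseds Y → (PrimeSpectrum (MvPolynomial (Fin n) k))ᵒᵈ := fun Z =>
    OrderDual.toDual ⟨(coneIdeal c (Z : Set Y)).comap f,
      have := hprime Z; Ideal.comap_isPrime f _⟩
  have hg : StrictMono g := fun Z W h => by
    refine OrderDual.toDual_lt_toDual.2 ?_
    exact hcomap _ _ (hprime W) (coneIdeal_anti (Set.subset_univ _))
      (hc.coneIdeal_lt Z.isClosed (SetLike.coe_ssubset_coe.2 h))
  have hm : (vanishingIdeal k {(0 : σ → k)}).IsMaximal := inferInstance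
  let m : (PrimeSpectrum (MvPolynomial (Fin n) k))ᵒᵈ :=
    OrderDual.toDual ⟨(vanishingIdeal k {(0 : σ → k)}).comap f, Ideal.comap_isPrime f _⟩
  have hlt : m < g q.head := by
    refine OrderDual.toDual_lt_toDual.2 ?_
    refine hcomap _ _ (hprime _) (coneIdeal_anti (Set.subset_univ _)) ?_
    obtain ⟨y, hy⟩ := q.head.isIrreducible.nonempty
    refine lt_of_le_not_ge (fun p hp => ?_) fun hle => hc.ne_zero y (funext fun i => ?_)
    · rw [mem_coneIdeal_iff] at hp
      simpa [aeval_eq_eval] using hp y hy 0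
    · have : (X i : MvPolynomial σ k) ∈ vanishingIdeal k {(0 : σ → k)} := by simp
      simpa using mem_coneIdeal_iff.1 (hle this) y hy 1
  have hlen := LTSeries.length_le_krullDim ((q.map g hg).cons m (by simpa using hlt))
  rw [krullDim_orderDual] at hlen
  have hdim : krullDim (PrimeSpectrum (MvPolynomial (Fin n) k)) = n := by
    have := MvPolynomial.ringKrullDim_of_isNoetherianRing (R := k) (ι := Fin n)
    rw [ringKrullDim_eq_zero_of_field] at this
    simpa [ringKrullDim] using this
  rw [hdim, RelSeries.cons_length] at hlen
  exact_mod_cast hlen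

end IsProjCoord

end ProjCoord

/-! ### Alternating forms and the Zariski topology of Grassmannians -/

section AlternatingForms

variable {k : Type*} [Field k] {E : Type*} [AddCommGroup E] [Module k E]

theorem exists_dual_family {n : ℕ} {v : Fin n → E} (hv : LinearIndependent k v) :
    ∃ f : Fin n → Module.Dual k E, ∀ i j, f j (v i) = (1 : Matrix (Fin n) (Fin n) k) i j := by
  obtain ⟨f, hf⟩ := (Finsupp.linearCombination k v).exists_leftInverse_of_injective
    (LinearMap.ker_eq_bot.2 hv)
  refine ⟨fun j => Finsupp.lapply j ∘ₗ f, fun i j => ?_⟩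
  have : f (v i) = Finsupp.single i 1 := by
    simpa using LinearMap.congr_fun hf (Finsupp.single i 1)
  simp [this, Matrix.one_apply, Finsupp.single_apply]

theorem exists_alternatingMap_apply_eq_one {n : ℕ} {v : Fin n → E} (hv : LinearIndependent k v) :
    ∃ θ : E [⋀^Fin n]→ₗ[k] k, θ v = 1 := by
  obtain ⟨f, hf⟩ := exists_dual_family hv
  refine ⟨Matrix.detRowAlternating.compLinearMap (LinearMap.pi f), ?_⟩
  change Matrix.det (fun i j => f j (v i)) = 1
  simp only [hf]
  exact Matrix.det_one

/-- An alternating form in `d + 1` variables, as a bilinear form on `E × ⋀ᵈ E`. -/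
noncomputable def contract {d : ℕ} (θ : E [⋀^Fin (d + 1)]→ₗ[k] k) :
    E →ₗ[k] ⋀[k]^d E →ₗ[k] k :=
  exteriorPower.alternatingMapLinearEquiv.toLinearMap ∘ₗ θ.curryLeft

@[simp]
theorem contract_apply {d : ℕ} (θ : E [⋀^Fin (d + 1)]→ₗ[k] k) (x : E) (w : Fin d → E) :
    contract θ x (exteriorPower.ιMulti k d w) = θ (Matrix.vecCons x w) := by
  simp [contract]

/-- A linear subspace is cut out by linear equations that depend linearly on its Plücker
coordinates. -/
theorem mem_span_iff_contract {d : ℕ} {w : Fin d → E} (hw : LinearIndependent k w) (x : E) :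
    x ∈ Submodule.span k (Set.range w) ↔
      ∀ θ : E [⋀^Fin (d + 1)]→ₗ[k] k, contract θ x (exteriorPower.ιMulti k d w) = 0 := by
  simp only [contract_apply]
  constructor
  · intro hx θ
    refine θ.map_linearDependent _ fun h => ?_
    exact (linearIndependent_finCons.1 h).2 hx
  · intro h
    by_contra hx
    obtain ⟨θ, hθ⟩ := exists_alternatingMap_apply_eq_one (linearIndependent_finCons.2 ⟨hw, hx⟩)
    exact one_ne_zero (hθ.symm.trans (h θ))

theorem ιMulti_ne_zero {d : ℕ} {w : Fin d → E} (hw : LinearIndependent k w) :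
    exteriorPower.ιMulti k d w ≠ 0 := by
  obtain ⟨θ, hθ⟩ := exists_alternatingMap_apply_eq_one hw
  intro h
  have := exteriorPower.alternatingMapLinearEquiv_apply_ιMulti θ w
  rw [h, map_zero, hθ] at this
  exact zero_ne_one this

/-- An alternating form is polynomial along a line in the space of its arguments. -/
theorem exists_polynomial_eval_eq {d : ℕ} (f : E [⋀^Fin d]→ₗ[k] k) (w w' : Fin d → E) :
    ∃ P : Polynomial k, ∀ t : k, P.eval t = f (w + t • w') := by
  classical
  refine ⟨∑ s : Finset (Fin d), Polynomial.C (f (s.piecewise w' w)) * Polynomial.X ^ s.card,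
    fun t => ?_⟩
  rw [add_comm, ← AlternatingMap.coe_multilinearMap, MultilinearMap.map_add_univ,
    Polynomial.eval_finsetSum]
  refine Finset.sum_congr rfl fun s _ => ?_
  have h := f.toMultilinearMap.map_piecewise_smul (fun _ => t) (s.piecewise w' w) s
  have h2 : s.piecewise (fun i => t • s.piecewise w' w i) (s.piecewise w' w)
      = s.piecewise (t • w') w := by
    ext i
    by_cases hi : i ∈ s <;> simp [hi]
  rw [h2, Finset.prod_const] at h
  change f _ = t ^ s.card * f _ at h
  change _ = f _
  rw [h, Polynomial.eval_mul, Polynomial.eval_C, Polynomial.eval_pow, Polynomial.eval_X, mul_comm]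
  rfl

end AlternatingForms

section DualPolynomials

open MvPolynomial

variable {k : Type*} [Field k] {P : Type*} [AddCommGroup P] [Module k P]

/-- The value at `x` of a polynomial in linear forms. -/
noncomputable def evalAt (x : P) : MvPolynomial (Module.Dual k P) k →+* k :=
  eval fun l : Module.Dual k P => l x

theorem evalAt_smul {p : MvPolynomial (Module.Dual k P) k} {n : ℕ} (hp : p.IsHomogeneous n)
    (t : k) (x : P) : evalAt (t • x) p = t ^ n * evalAt x p := by
  rw [evalAt, evalAt, ← eval_smul_of_isHomogeneous hp]
  congr 2
  ext l
  simp

theorem evalAt_smul_eq_zero_iff {p : MvPolynomial (Module.Dual k P) k} {n : ℕ}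
    (hp : p.IsHomogeneous n) {t : k} (ht : t ≠ 0) (x : P) :
    evalAt (t • x) p = 0 ↔ evalAt x p = 0 := by
  rw [evalAt_smul hp, mul_eq_zero, or_iff_right (pow_ne_zero n ht)]

/-- Spanning a fixed finite-dimensional space is an open condition on a family of vectors depending
linearly on a parameter. -/
theorem exists_isHomogeneous_span_eq_top {W : Type*} [AddCommGroup W] [Module k W]
    [FiniteDimensional k W] {ι : Type*} (v : ι → P →ₗ[k] W) (x₀ : P)
    (h : Submodule.span k (Set.range fun i => v i x₀) = ⊤) :
    ∃ F : MvPolynomial (Module.Dual k P) k, (∃ n, F.IsHomogeneous n) ∧ evalAt x₀ F ≠ 0 ∧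
      ∀ x, evalAt x F ≠ 0 → Submodule.span k (Set.range fun i => v i x) = ⊤ := by
  classical
  obtain ⟨κ, a, ha, hspan, hli⟩ := exists_linearIndependent' k fun i => v i x₀
  let b : Module.Basis κ k W := .mk hli (by rw [hspan, h])
  have : Fintype κ := FiniteDimensional.fintypeBasisIndex b
  let M : Matrix κ κ (MvPolynomial (Module.Dual k P) k) :=
    Matrix.of fun i j => X ((b.coord i) ∘ₗ v (a j))
  have hM (x : P) : evalAt x M.det = b.det fun j => v (a j) x := by
    rw [RingHom.map_det, Module.Basis.det_apply]
    congr 1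
    ext i j
    simp [M, evalAt, Module.Basis.toMatrix_apply]
  refine ⟨M.det, ⟨Fintype.card κ, ?_⟩, ?_, fun x hx => ?_⟩
  · rw [Matrix.det_apply]
    refine IsHomogeneous.sum _ _ _ fun e _ => ?_
    have : (∏ i, M (e i) i).IsHomogeneous (Fintype.card κ) := by
      have := IsHomogeneous.prod Finset.univ (fun i => M (e i) i) (fun _ => 1)
        fun i _ => isHomogeneous_X _ _
      simpa using this
    rw [Units.smul_def, zsmul_eq_mul]
    have hC : ((Equiv.Perm.sign e : ℤ) : MvPolynomial (Module.Dual k P) k)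
      = C ((Equiv.Perm.sign e : ℤ) : k) := by simp
    rw [hC]
    exact this.C_mul _
  · rw [hM]
    have : (fun j => v (a j) x₀) = b := by
      ext j; simp [b]
    rw [this, Module.Basis.det_self]
    exact one_ne_zero
  · rw [hM] at hx
    obtain ⟨-, hsp⟩ := (Module.Basis.is_basis_iff_det b).2 (isUnit_iff_ne_zero.2 hx)
    rw [eq_top_iff, ← hsp, Submodule.span_le]
    rintro _ ⟨j, rfl⟩
    exact Submodule.subset_span ⟨a j, rfl⟩

end DualPolynomials

theorem isClosed_projZariski_iff {k : Type*} [Field k] {P : Type*} [AddCommGroup P] [Module k P]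
    (Z : Set (ℙ k P)) : @IsClosed _ (projZariski k P) Z ↔
      ∃ T : Set (MvPolynomial (Module.Dual k P) k),
        (∀ p ∈ T, ∃ n : ℕ, p.IsHomogeneous n) ∧ Z = projZeroLocus k P T := by
  rw [← @isOpen_compl_iff _ _ (projZariski k P)]
  change Zᶜᶜ ∈ _ ↔ _
  rw [compl_compl]
  rfl

section PlueckerCoordinates

open MvPolynomial

variable {k : Type*} [Field k] {d : ℕ} {E : Type*} [AddCommGroup E] [Module k E]
  [FiniteDimensional k E]

namespace Gr

/-- A basis of a point of the Grassmannian. -/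
noncomputable def frame (W : Gr k d E) : Fin d → E :=
  fun i => (Module.finBasisOfFinrankEq k W.1 W.2 i : E)

theorem linearIndependent_frame (W : Gr k d E) : LinearIndependent k W.frame :=
  (Module.finBasisOfFinrankEq k W.1 W.2).linearIndependent.map' W.1.subtype W.1.ker_subtype

theorem span_frame (W : Gr k d E) : Submodule.span k (Set.range W.frame) = W.1 := by
  have : W.frame = W.1.subtype ∘ Module.finBasisOfFinrankEq k W.1 W.2 := rfl
  rw [this, Set.range_comp, ← Submodule.map_span, Module.Basis.span_eq, Submodule.map_subtype_top]

theorem frame_mem (W : Gr k d E) (i : Fin d) : W.frame i ∈ W.1 :=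
  (Module.finBasisOfFinrankEq k W.1 W.2 i).2

/-- The vector of Plücker coordinates of `W`. -/
noncomputable def vec (W : Gr k d E) : ⋀[k]^d E := exteriorPower.ιMulti k d W.frame

/-- The span of a linearly independent family. -/
def ofFrame (w : Fin d → E) (hw : LinearIndependent k w) : Gr k d E :=
  ⟨Submodule.span k (Set.range w), by rw [finrank_span_eq_card hw, Fintype.card_fin]⟩

end Gr

theorem exists_plucker_rep_eq (W : Gr k d E) {w : Fin d → E} (hw : LinearIndependent k w)
    (hW : Submodule.span k (Set.range w) = W.1) :
    ∃ t : k, t ≠ 0 ∧ (plucker k d E W).rep = t • exteriorPower.ιMulti k d w := by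
  have hmem : exteriorPower.ιMulti k d w ∈ (plucker k d E W).submodule := by
    rw [plucker, Projectivization.submodule_mk'']
    have hw' (i : Fin d) : w i ∈ W.1 := hW ▸ Submodule.subset_span ⟨i, rfl⟩
    refine ⟨exteriorPower.ιMulti k d fun i => ⟨w i, hw' i⟩, ?_⟩
    rw [exteriorPower.map_apply_ιMulti]
    rfl
  rw [Projectivization.submodule_eq, Submodule.mem_span_singleton] at hmem
  obtain ⟨a, ha⟩ := hmem
  have ha0 : a ≠ 0 := by
    rintro rfl
    exact ιMulti_ne_zero hw (by rw [← ha, zero_smul])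
  exact ⟨a⁻¹, inv_ne_zero ha0, by rw [← ha, smul_smul, inv_mul_cancel₀ ha0, one_smul]⟩

namespace Gr

theorem exists_ιMulti_eq_smul_vec (W : Gr k d E) {w : Fin d → E} (hw : LinearIndependent k w)
    (hW : Submodule.span k (Set.range w) = W.1) :
    ∃ t : k, t ≠ 0 ∧ exteriorPower.ιMulti k d w = t • W.vec := by
  obtain ⟨t, ht, h⟩ := exists_plucker_rep_eq W hw hW
  obtain ⟨s, hs, h'⟩ := exists_plucker_rep_eq W W.linearIndependent_frame W.span_frame
  refine ⟨t⁻¹ * s, mul_ne_zero (inv_ne_zero ht) hs, ?_⟩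
  rw [mul_smul, vec, ← h', h, smul_smul, inv_mul_cancel₀ ht, one_smul]

theorem isClosed_iff (Z : Set (Gr k d E)) :
    IsClosed Z ↔ ∃ T : Set (MvPolynomial (Module.Dual k (⋀[k]^d E)) k),
      (∀ p ∈ T, ∃ n, p.IsHomogeneous n) ∧ Z = {W | ∀ p ∈ T, evalAt W.vec p = 0} := by
  have hrep (W : Gr k d E) (p : MvPolynomial (Module.Dual k (⋀[k]^d E)) k)
      (hp : ∃ n, p.IsHomogeneous n) : evalAt (plucker k d E W).rep p = 0 ↔ evalAt W.vec p = 0 := by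
    obtain ⟨s, hs, h⟩ := exists_plucker_rep_eq W W.linearIndependent_frame W.span_frame
    obtain ⟨n, hn⟩ := hp
    rw [h, evalAt_smul_eq_zero_iff hn hs, vec]
  have hT (T : Set (MvPolynomial (Module.Dual k (⋀[k]^d E)) k))
      (hT : ∀ p ∈ T, ∃ n, p.IsHomogeneous n) :
      plucker k d E ⁻¹' projZeroLocus k (⋀[k]^d E) T = {W | ∀ p ∈ T, evalAt W.vec p = 0} := by
    ext W
    exact forall₂_congr fun p hp => hrep W p (hT p hp)
  rw [@isClosed_induced_iff _ _ (projZariski k (⋀[k]^d E))]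
  constructor
  · rintro ⟨Z', hZ', rfl⟩
    rw [isClosed_projZariski_iff] at hZ'
    obtain ⟨T, h, rfl⟩ := hZ'
    exact ⟨T, h, hT T h⟩
  · rintro ⟨T, h, rfl⟩
    refine ⟨projZeroLocus k (⋀[k]^d E) T, ?_, hT T h⟩
    rw [isClosed_projZariski_iff]
    exact ⟨T, h, rfl⟩

theorem isOpen_iff (O : Set (Gr k d E)) :
    IsOpen O ↔ ∀ W ∈ O, ∃ F : MvPolynomial (Module.Dual k (⋀[k]^d E)) k, (∃ n, F.IsHomogeneous n) ∧
      evalAt W.vec F ≠ 0 ∧ ∀ W' : Gr k d E, evalAt W'.vec F ≠ 0 → W' ∈ O := by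
  rw [← isClosed_compl_iff, isClosed_iff]
  constructor
  · rintro ⟨T, hT, h⟩ W hW
    have : W ∉ Oᶜ := fun h => h hW
    rw [h] at this
    simp only [Set.mem_ofPred_eq, not_forall] at this
    obtain ⟨F, hF, hne⟩ := this
    refine ⟨F, hT F hF, hne, fun W' hW' => ?_⟩
    by_contra hcon
    have : W' ∈ Oᶜ := hcon
    rw [h] at this
    exact hW' (this F hF)
  · intro h
    refine ⟨{F | (∃ n, F.IsHomogeneous n) ∧ ∀ W ∈ Oᶜ, evalAt W.vec F = 0}, fun p hp => hp.1, ?_⟩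
    ext W
    constructor
    · exact fun hW p hp => hp.2 W hW
    · intro hW hWO
      obtain ⟨F, hF, hne, hF'⟩ := h W hWO
      refine hne (hW F ⟨hF, fun W' hW' => ?_⟩)
      by_contra hcon
      exact hW' (hF' W' hcon)

/-- The Grassmannian is irreducible: two points are joined by a rational curve, on which nonempty
open sets are cofinite. -/
instance preirreducibleSpace [Infinite k] : PreirreducibleSpace (Gr k d E) := by
  refine .of_forall_nonempty_inter ?_
  intro O₁ O₂ h₁ h₂ ⟨W₁, hW₁⟩ ⟨W₂, hW₂⟩
  obtain ⟨F₁, ⟨n₁, hn₁⟩, hF₁, hO₁⟩ := (isOpen_iff O₁).1 h₁ W₁ hW₁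
  obtain ⟨F₂, ⟨n₂, hn₂⟩, hF₂, hO₂⟩ := (isOpen_iff O₂).1 h₂ W₂ hW₂
  set w₁ := W₁.frame
  set w₂ := W₂.frame
  let w : k → Fin d → E := fun t => w₁ + t • (w₂ - w₁)
  have hw0 : w 0 = w₁ := by simp [w]
  have hw1 : w 1 = w₂ := by simp [w]
  choose Q hQ using fun l : Module.Dual k (⋀[k]^d E) =>
    exists_polynomial_eval_eq (exteriorPower.alternatingMapLinearEquiv.symm l) w₁ (w₂ - w₁)
  have hline (F : MvPolynomial (Module.Dual k (⋀[k]^d E)) k) (t : k) :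
      (aeval Q F).eval t = evalAt (exteriorPower.ιMulti k d (w t)) F := by
    rw [← Polynomial.coe_evalRingHom, aeval_def, hom_eval₂, evalAt, eval, coe_eval₂Hom]
    congr 1
    · ext a; simp
    · ext l
      simp only [Polynomial.coe_evalRingHom, hQ]
      simp [exteriorPower.alternatingMapLinearEquiv_symm_apply, w]
  obtain ⟨θ, hθ⟩ := exists_alternatingMap_apply_eq_one W₁.linearIndependent_frame
  obtain ⟨P, hP⟩ := exists_polynomial_eval_eq θ w₁ (w₂ - w₁)
  have hP0 : P ≠ 0 := by
    rintro rfl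
    have := hP 0
    change _ = θ (w 0) at this
    rw [hw0, hθ] at this
    simp at this
  have hG₁ : aeval Q F₁ ≠ 0 := by
    intro h
    have := hline F₁ 0
    rw [h, hw0, Polynomial.eval_zero] at this
    exact hF₁ this.symm
  have hG₂ : aeval Q F₂ ≠ 0 := by
    intro h
    have := hline F₂ 1
    rw [h, hw1, Polynomial.eval_zero] at this
    exact hF₂ this.symm
  obtain ⟨t, ht⟩ : ∃ t, (P * aeval Q F₁ * aeval Q F₂).eval t ≠ 0 := by
    by_contra! h
    exact mul_ne_zero (mul_ne_zero hP0 hG₁) hG₂ (Polynomial.funext fun t => by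
      rw [h t, Polynomial.eval_zero])
  simp only [Polynomial.eval_mul, hline, hP] at ht
  have hli : LinearIndependent k (w t) := by
    by_contra hcon
    exact ht (by rw [show w₁ + t • (w₂ - w₁) = w t from rfl, θ.map_linearDependent _ hcon]; simp)
  have key (F : MvPolynomial (Module.Dual k (⋀[k]^d E)) k) {n : ℕ} (hn : F.IsHomogeneous n)
      (h : evalAt (exteriorPower.ιMulti k d (w t)) F ≠ 0) :
      evalAt (ofFrame (w t) hli).vec F ≠ 0 := by
    obtain ⟨s, hs, hs'⟩ := exists_ιMulti_eq_smul_vec (ofFrame (w t) hli) hli rfl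
    rwa [hs', Ne, evalAt_smul_eq_zero_iff hn hs] at h
  exact ⟨ofFrame (w t) hli, hO₁ _ (key F₁ hn₁ (by aesop)), hO₂ _ (key F₂ hn₂ (by aesop))⟩

/-- Linear forms spanning the dual of `⋀ᵈ E` are homogeneous coordinates on the Grassmannian. -/
theorem isProjCoord {σ : Type*} [Fintype σ] (f : σ → Module.Dual k (⋀[k]^d E))
    (hf : ∀ l : Module.Dual k (⋀[k]^d E), l ∈ Submodule.span k (Set.range f)) :
    IsProjCoord fun (W : Gr k d E) (i : σ) => f i W.vec where
  ne_zero W h := by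
    obtain ⟨θ, hθ⟩ := exists_alternatingMap_apply_eq_one W.linearIndependent_frame
    obtain ⟨a, ha⟩ := (Submodule.mem_span_range_iff_exists_fun k).1
      (hf (exteriorPower.alternatingMapLinearEquiv θ))
    have h1 : exteriorPower.alternatingMapLinearEquiv θ W.vec = 1 := by
      rw [vec, exteriorPower.alternatingMapLinearEquiv_apply_ιMulti, hθ]
    rw [← ha, LinearMap.sum_apply, Finset.sum_eq_zero] at h1
    · exact zero_ne_one h1
    · intro i _
      have : f i W.vec = 0 := congrFun h i
      rw [LinearMap.smul_apply, this, smul_zero]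
  isClosed_iff Z := by
    choose a ha using fun l => (Submodule.mem_span_range_iff_exists_fun k).1 (hf l)
    rw [Gr.isClosed_iff]
    constructor
    · rintro ⟨T, hT, rfl⟩
      refine ⟨(aeval fun l => linForm (a l)) '' T, ?_, ?_⟩
      · rintro _ ⟨p, hp, rfl⟩
        obtain ⟨n, hn⟩ := hT p hp
        have := hn.aeval (fun l => linForm (a l)) fun l => linForm_isHomogeneous (a l)
        exact ⟨_, this⟩
      · ext W
        simp only [Set.mem_ofPred_eq, Set.forall_mem_image]
        refine forall₂_congr fun p hp => ?_
        have : eval (fun i => f i W.vec) (aeval (fun l => linForm (a l)) p) = evalAt W.vec p := by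
          rw [aeval_def, hom_eval₂, evalAt, eval, coe_eval₂Hom]
          congr 1
          · ext x; simp
          · ext l
            conv_rhs => rw [← ha l]
            simp [linForm]
        rw [this]
    · rintro ⟨T, hT, rfl⟩
      refine ⟨rename f '' T, ?_, ?_⟩
      · rintro _ ⟨p, hp, rfl⟩
        obtain ⟨n, hn⟩ := hT p hp
        exact ⟨n, hn.rename_isHomogeneous⟩
      · ext W
        simp only [Set.mem_ofPred_eq, Set.forall_mem_image]
        refine forall₂_congr fun p hp => ?_
        rw [evalAt, eval_rename]
        rfl

end Gr

end PlueckerCoordinates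

/-! ### Elimination theory -/

section Elimination

open MvPolynomial

variable {k : Type*} [Field k] {E : Type*} [AddCommGroup E] [Module k E] {σ : Type*} [Fintype σ]

/-- Rewriting polynomials in linear forms as polynomials in the coordinates of a basis. -/
noncomputable def toCoord (b : Module.Basis σ k E) :
    MvPolynomial (Module.Dual k E) k →ₐ[k] MvPolynomial σ k :=
  aeval fun l => linForm fun i => l (b i)

theorem eval_toCoord (b : Module.Basis σ k E) (p : MvPolynomial (Module.Dual k E) k) (x : E) :
    eval (b.repr x) (toCoord b p) = evalAt x p := by
  rw [toCoord, aeval_def, hom_eval₂, evalAt, eval, coe_eval₂Hom]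
  congr 1
  · ext a; simp
  · ext l
    conv_rhs => rw [← b.sum_repr x]
    simp [linForm, mul_comm, -Module.Basis.sum_repr]

theorem isHomogeneous_toCoord (b : Module.Basis σ k E) {p : MvPolynomial (Module.Dual k E) k}
    {n : ℕ} (hp : p.IsHomogeneous n) : (toCoord b p).IsHomogeneous n := by
  have := hp.aeval (fun l : Module.Dual k E => linForm fun i => l (b i))
    fun l => linForm_isHomogeneous _
  rwa [one_mul] at this

/-- An ideal generated by homogeneous polynomials contains the homogeneous components of its
elements. -/
theorem homogeneousComponent_mem_span {σ : Type*} {T : Set (MvPolynomial σ k)}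
    (hT : ∀ p ∈ T, ∃ n, p.IsHomogeneous n) {p : MvPolynomial σ k} (hp : p ∈ Ideal.span T) (n : ℕ) :
    homogeneousComponent n p ∈ Ideal.span T := by
  let _ := MvPolynomial.gradedAlgebra (σ := σ) (R := k)
  exact homogeneousComponent_mem_of_mem
    (Ideal.homogeneous_span (homogeneousSubmodule σ k) T fun p hp => hT p hp) hp n

variable [FiniteDimensional k E] {d : ℕ}

/-- Elimination theory: meeting a fixed cone outside the origin is a closed condition on a linear
subspace. If it fails at `R₀`, then for some `N` the equations of the cone and those of `R₀`
generate all forms of degree `N`, and this remains true near `R₀`. -/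
theorem isClosed_setOf_exists_mem_cone [IsAlgClosed k] (T : Set (MvPolynomial (Module.Dual k E) k))
    (hT : ∀ p ∈ T, ∃ n, p.IsHomogeneous n) :
    IsClosed {R : Gr k d E | ∃ r ∈ R.1, r ≠ 0 ∧ ∀ p ∈ T, evalAt r p = 0} := by
  rw [← isOpen_compl_iff, Gr.isOpen_iff]
  intro R₀ hR₀
  let b := Module.finBasis k E
  let A : Ideal (MvPolynomial (Fin (Module.finrank k E)) k) := Ideal.span (toCoord b '' T)
  have hTA : ∀ p ∈ toCoord b '' T, ∃ n, p.IsHomogeneous n := by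
    rintro _ ⟨p, hp, rfl⟩
    obtain ⟨n, hn⟩ := hT p hp
    exact ⟨n, isHomogeneous_toCoord b hn⟩
  let L (θ : E [⋀^Fin (d + 1)]→ₗ[k] k) (p : ⋀[k]^d E) : Fin (Module.finrank k E) → k :=
    fun i => contract θ (b i) p
  have hL (θ : E [⋀^Fin (d + 1)]→ₗ[k] k) (p : ⋀[k]^d E) (x : E) :
      eval (b.repr x) (linForm (L θ p)) = contract θ x p := by
    conv_rhs => rw [← b.sum_repr x]
    simp [L, dotProduct, mul_comm, -Module.Basis.sum_repr]
  obtain ⟨M, hM⟩ := exists_forall_isHomogeneous_mem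
    (J := A ⊔ Ideal.span (Set.range fun θ => linForm (L θ R₀.vec))) (by
      intro x hx
      obtain ⟨r, rfl⟩ : ∃ r, ⇑(b.repr r) = x := ⟨b.equivFun.symm x, by
        rw [← b.equivFun_apply, LinearEquiv.apply_symm_apply]⟩
      by_contra hr
      refine hR₀ ⟨r, ?_, fun h => hr (by simp [h]), fun p hp => ?_⟩
      · rw [← R₀.span_frame, mem_span_iff_contract R₀.linearIndependent_frame]
        intro θ
        rw [← Gr.vec, ← hL]
        exact hx _ (Ideal.mem_sup_right (Ideal.subset_span ⟨θ, rfl⟩))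
      · rw [← eval_toCoord b]
        exact hx _ (Ideal.mem_sup_left (Ideal.subset_span ⟨p, hp, rfl⟩)))
  let H (n : ℕ) := homogeneousSubmodule (Fin (Module.finrank k E)) k n
  have hfin : FiniteDimensional k (H (M + 1)) :=
    Module.Finite.iff_fg.2 (homogeneousSubmodule_fg _ k _)
  let K : Submodule k (H (M + 1)) := (A.restrictScalars k).comap (H (M + 1)).subtype
  let v (a : H M × (E [⋀^Fin (d + 1)]→ₗ[k] k)) : ⋀[k]^d E →ₗ[k] H (M + 1) ⧸ K :=
    K.mkQ ∘ₗ
      { toFun := fun p => ⟨a.1 * linForm (L a.2 p), a.1.2.mul (linForm_isHomogeneous _)⟩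
        map_add' := fun p q => by
          ext1
          simp [linForm, L, add_mul, Finset.sum_add_distrib, mul_add]
        map_smul' := fun t p => by
          ext1
          simp [linForm, L, Finset.mul_sum, Finset.smul_sum, MvPolynomial.smul_eq_C_mul]
          refine Finset.sum_congr rfl fun i _ => by ring }
  obtain ⟨F, hF, hF0, hspan⟩ := exists_isHomogeneous_span_eq_top v R₀.vec (by
    rw [eq_top_iff]
    rintro x -
    obtain ⟨⟨q, hq⟩, rfl⟩ := K.mkQ_surjective x
    obtain ⟨a, ha, c, hc, hac⟩ := Submodule.mem_sup.1 (hM (M + 1) (by omega) q hq)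
    obtain ⟨s, hs⟩ := (Finsupp.mem_ideal_span_range_iff_exists_finsupp).1 hc
    have hdecomp : q = homogeneousComponent (M + 1) a +
        ∑ θ ∈ s.support, homogeneousComponent M (s θ) * linForm (L θ R₀.vec) := by
      conv_lhs => rw [← homogeneousComponent_eq_self hq, ← hac, map_add, ← hs, Finsupp.sum, map_sum]
      congr 1
      refine Finset.sum_congr rfl fun θ _ => ?_
      rw [mul_comm, homogeneousComponent_add_mul (linForm_isHomogeneous _), mul_comm]
    have : K.mkQ ⟨q, hq⟩ = ∑ θ ∈ s.support,
        v (⟨homogeneousComponent M (s θ), homogeneousComponent_isHomogeneous _ _⟩, θ) R₀.vec := by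
      simp only [v, LinearMap.comp_apply, ← map_sum]
      rw [← sub_eq_zero, ← map_sub, Submodule.mkQ_apply, Submodule.Quotient.mk_eq_zero]
      change _ ∈ A
      convert homogeneousComponent_mem_span hTA ha (M + 1) using 1
      simp [hdecomp]
    rw [this]
    exact Submodule.sum_mem _ fun θ _ => Submodule.subset_span ⟨_, rfl⟩)
  refine ⟨F, hF, hF0, fun R hFR => ?_⟩
  rintro ⟨r, hrR, hr0, hrT⟩
  -- evaluation at `r` kills the equations of `R`, hence all forms of degree `M + 1`
  let ev : (H (M + 1) ⧸ K) →ₗ[k] k := K.liftQ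
    ((aeval (b.repr r) : MvPolynomial _ k →ₐ[k] k).toLinearMap ∘ₗ (H (M + 1)).subtype) (by
      rintro ⟨q, hq⟩ hqA
      have hA : A ≤ RingHom.ker (eval (b.repr r)) := by
        rw [Ideal.span_le]
        rintro _ ⟨p, hp, rfl⟩
        exact (eval_toCoord b p r).trans (hrT p hp)
      simpa [aeval_eq_eval] using hA hqA)
  have hev : ev = 0 := by
    refine LinearMap.ext_on_range (hspan R.vec hFR) fun a => ?_
    have hr : contract a.2 r R.vec = 0 := by
      rw [← R.span_frame, mem_span_iff_contract R.linearIndependent_frame] at hrR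
      exact hrR a.2
    simp [ev, v, aeval_eq_eval, -eval_linForm, hL, hr]
  refine hr0 (b.repr.injective (Finsupp.ext fun i => ?_))
  have : ev (K.mkQ ⟨X i ^ (M + 1), isHomogeneous_X_pow i (M + 1)⟩) = 0 := by rw [hev]; rfl
  simpa [ev] using this

end Elimination

/-! ### Plücker coordinates of planes and the cone over `X_R` -/

theorem span_range_dual_eq_top_iff {k W ι : Type*} [Field k] [AddCommGroup W] [Module k W]
    [FiniteDimensional k W] (f : ι → Module.Dual k W) :
    Submodule.span k (Set.range f) = ⊤ ↔ ∀ w, (∀ i, f i w = 0) → w = 0 := by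
  have hmem (w : W) : w ∈ (Submodule.span k (Set.range f)).dualCoannihilator ↔ ∀ i, f i w = 0 := by
    rw [← SetLike.mem_coe, Submodule.coe_dualCoannihilator_span]
    simp
  constructor
  · intro h w hw
    rw [← hmem, h, Submodule.dualCoannihilator_top] at hw
    exact hw
  · intro h
    have h0 : (Submodule.span k (Set.range f)).dualCoannihilator = ⊥ :=
      (Submodule.eq_bot_iff _).2 fun w hw => h w ((hmem w).1 hw)
    rw [← Subspace.dualCoannihilator_dualAnnihilator_eq (W := Submodule.span k (Set.range f)), h0,
      Submodule.dualAnnihilator_bot]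

section Columns

variable {k : Type*} [Field k] {V : Type*} [AddCommGroup V] [Module k V] {n : ℕ}
  (b : Module.Basis (Fin n) k V)

/-- The columns of a tensor: `r = ∑ j, col b j r ⊗ b j`. -/
noncomputable def col (j : Fin n) : V ⊗[k] V →ₗ[k] V :=
  (TensorProduct.rid k V).toLinearMap ∘ₗ LinearMap.lTensor V (b.coord j)

@[simp]
theorem col_tmul (j : Fin n) (u v : V) : col b j (u ⊗ₜ v) = b.coord j v • u := by
  simp [col]

theorem sum_col_tmul (r : V ⊗[k] V) : ∑ j, col b j r ⊗ₜ[k] b j = r := by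
  induction r using TensorProduct.induction_on with
  | zero => simp
  | tmul u v =>
    conv_rhs => rw [← b.sum_repr v]
    simp [TensorProduct.tmul_sum, TensorProduct.smul_tmul, -Module.Basis.sum_repr]
  | add x y hx hy =>
    conv_rhs => rw [← hx, ← hy]
    simp [TensorProduct.add_tmul, Finset.sum_add_distrib]

theorem exists_col_ne_zero {r : V ⊗[k] V} (hr : r ≠ 0) : ∃ j, col b j r ≠ 0 := by
  by_contra! h
  refine hr ?_
  rw [← sum_col_tmul b r]
  simp [h]

theorem mem_range_rTensor_iff {Q : Submodule k V} {r : V ⊗[k] V} :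
    r ∈ LinearMap.range (LinearMap.rTensor V Q.subtype) ↔ ∀ j, col b j r ∈ Q := by
  constructor
  · rintro ⟨x, rfl⟩ j
    induction x using TensorProduct.induction_on with
    | zero => simp
    | tmul u v => simpa using Q.smul_mem _ u.2
    | add x y hx hy => simpa using Q.add_mem hx hy
  · intro h
    rw [← sum_col_tmul b r]
    exact Submodule.sum_mem _ fun j _ => ⟨⟨col b j r, h j⟩ ⊗ₜ b j, by simp⟩

/-- The `2 × 2` minor of two vectors in rows `i`, `j`, as a linear form on `⋀² V`. -/
noncomputable def minor (p : Fin n × Fin n) : Module.Dual k (⋀[k]^2 V) :=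
  exteriorPower.alternatingMapLinearEquiv
    (Matrix.detRowAlternating.compLinearMap (LinearMap.pi ![b.coord p.1, b.coord p.2]))

theorem minor_ιMulti (p : Fin n × Fin n) (w : Fin 2 → V) :
    minor b p (exteriorPower.ιMulti k 2 w) =
      b.repr (w 0) p.1 * b.repr (w 1) p.2 - b.repr (w 0) p.2 * b.repr (w 1) p.1 := by
  rw [minor, exteriorPower.alternatingMapLinearEquiv_apply_ιMulti]
  refine (Matrix.det_fin_two _).trans ?_
  simp

/-- The minors span the dual of `⋀² V`. Only those with `p.1 < p.2` are used, which avoids dividing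
by two. -/
theorem mem_span_minor (l : Module.Dual k (⋀[k]^2 V)) :
    l ∈ Submodule.span k (Set.range (minor b)) := by
  have : l = ∑ p : Fin n × Fin n, (if p.1 < p.2 then l (exteriorPower.ιMulti k 2 ![b p.1, b p.2])
      else 0) • minor b p := by
    refine exteriorPower.linearMap_ext (Module.Basis.ext_alternating b fun v hv => ?_)
    simp only [LinearMap.compAlternatingMap_apply]
    have hne : v 0 ≠ v 1 := fun h => zero_ne_one (hv h)
    have hv' : (fun i => b (v i)) = ![b (v 0), b (v 1)] := by
      ext i; fin_cases i <;> rfl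
    have hswap : l (exteriorPower.ιMulti k 2 ![b (v 1), b (v 0)]) =
        - l (exteriorPower.ιMulti k 2 ![b (v 0), b (v 1)]) := by
      rw [← map_neg, ← AlternatingMap.map_swap _ _ (show (0 : Fin 2) ≠ 1 by decide)]
      congr 2
    simp only [LinearMap.sum_apply, LinearMap.smul_apply, minor_ιMulti, Fintype.sum_prod_type,
      Module.Basis.repr_self, Finsupp.single_apply, smul_eq_mul, mul_sub, Finset.sum_sub_distrib]
    rw [hv']
    rcases lt_or_gt_of_ne hne with h | h
    · simp [h, h.not_gt]
    · simp [h, h.not_gt, hswap]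
  rw [this]
  exact Submodule.sum_mem _ fun p _ => Submodule.smul_mem _ _ (Submodule.subset_span ⟨p, rfl⟩)

/-- The Plücker coordinates of a plane, as a skew-symmetric matrix. -/
noncomputable def coords [FiniteDimensional k V] (Q : Gr k 2 V) (p : Fin n × Fin n) : k :=
  minor b p Q.vec

theorem isProjCoord_coords [FiniteDimensional k V] :
    IsProjCoord (coords b : Gr k 2 V → Fin n × Fin n → k) :=
  Gr.isProjCoord (minor b) (mem_span_minor b)

theorem coords_eq [FiniteDimensional k V] (Q : Gr k 2 V) (p : Fin n × Fin n) : coords b Q p =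
    b.repr (Q.frame 0) p.1 * b.repr (Q.frame 1) p.2 -
      b.repr (Q.frame 0) p.2 * b.repr (Q.frame 1) p.1 :=
  minor_ιMulti b p _

theorem Gr.mem_iff_frame [FiniteDimensional k V] (Q : Gr k 2 V) (v : V) :
    v ∈ Q.1 ↔ ∃ s t : k, s • Q.frame 0 + t • Q.frame 1 = v := by
  rw [← Q.span_frame, ← Submodule.mem_span_pair]
  have : Set.range Q.frame = {Q.frame 0, Q.frame 1} := by
    ext x
    simp [Fin.exists_fin_two, eq_comm]
  rw [this]

/-- The vanishing of a column of `r` wedged with the skew-symmetric matrix `x`. -/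
noncomputable def wedgeForm (a : Fin n × Fin n × Fin n × Fin n) :
    (Fin n × Fin n → k) →ₗ[k] Module.Dual k (V ⊗[k] V) :=
  (LinearMap.proj (a.2.2.1, a.2.2.2)).smulRight (b.coord a.2.1 ∘ₗ col b a.1) -
  (LinearMap.proj (a.2.1, a.2.2.2)).smulRight (b.coord a.2.2.1 ∘ₗ col b a.1) +
  (LinearMap.proj (a.2.1, a.2.2.1)).smulRight (b.coord a.2.2.2 ∘ₗ col b a.1)

theorem wedgeForm_apply (m i j l : Fin n) (x : Fin n × Fin n → k) (r : V ⊗[k] V) :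
    wedgeForm b (m, i, j, l) x r = x (j, l) * b.repr (col b m r) i -
      x (i, l) * b.repr (col b m r) j + x (i, j) * b.repr (col b m r) l := by
  simp [wedgeForm]

theorem wedgeForm_coords [FiniteDimensional k V] {Q : Gr k 2 V} {r : V ⊗[k] V}
    (h : ∀ j, col b j r ∈ Q.1) (a : Fin n × Fin n × Fin n × Fin n) :
    wedgeForm b a (coords b Q) r = 0 := by
  obtain ⟨m, i, j, l⟩ := a
  obtain ⟨s, t, hst⟩ := (Q.mem_iff_frame _).1 (h m)
  rw [wedgeForm_apply, ← hst]
  simp only [coords_eq, map_add, map_smul, Finsupp.add_apply, Finsupp.smul_apply, smul_eq_mul]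
  ring

/-- A nonzero skew-symmetric matrix `x` with `r ∧ x = 0` for some `r ≠ 0` is decomposable: if
`v` is a nonzero column of `r`, then `v ∧ x = 0` gives `x = v ∧ u` for a suitable `u`. -/
theorem exists_coords_eq_of_wedgeForm [FiniteDimensional k V] {x : Fin n × Fin n → k} (hx : x ≠ 0)
    {r : V ⊗[k] V} (hr : r ≠ 0) (h : ∀ a, wedgeForm b a x r = 0) :
    ∃ Q : Gr k 2 V, (∀ j, col b j r ∈ Q.1) ∧ ∃ t : k, x = t • coords b Q := by
  obtain ⟨m, hm⟩ := exists_col_ne_zero b hr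
  set v := col b m r with hv
  obtain ⟨i, hi⟩ : ∃ i, b.repr v i ≠ 0 := by
    by_contra! hcon
    exact hm (b.repr.injective (by ext i; simpa using hcon i))
  let u : V := b.equivFun.symm fun j => x (i, j) / b.repr v i
  have hu (j : Fin n) : b.repr u j = x (i, j) / b.repr v i := by
    have := congrFun (b.equivFun.apply_symm_apply fun j => x (i, j) / b.repr v i) j
    rwa [b.equivFun_apply] at this
  have hx' (j l : Fin n) : x (j, l) = b.repr v j * b.repr u l - b.repr v l * b.repr u j := by
    have := h (m, i, j, l)
    rw [wedgeForm_apply, ← hv] at this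
    rw [hu, hu]
    field_simp
    linear_combination this
  have hli : LinearIndependent k ![v, u] := by
    rw [LinearIndependent.pair_iff' hm]
    intro a ha
    refine hx (funext fun ⟨j, l⟩ => ?_)
    rw [hx', ← ha]
    simp only [map_smul, Finsupp.smul_apply, smul_eq_mul, Pi.zero_apply]
    ring
  refine ⟨Gr.ofFrame _ hli, fun j => ?_, ?_⟩
  · obtain ⟨⟨p, q⟩, hpq⟩ : ∃ p, x p ≠ 0 := by
      by_contra! hcon
      exact hx (funext hcon)
    change _ ∈ Submodule.span k (Set.range ![v, u])
    set s := col b j r with hs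
    rw [Matrix.range_cons, Matrix.range_cons, Matrix.range_empty, Set.union_empty,
      Set.singleton_union, Submodule.mem_span_pair]
    refine ⟨(b.repr s p * b.repr u q - b.repr s q * b.repr u p) / x (p, q),
      (b.repr s q * b.repr v p - b.repr s p * b.repr v q) / x (p, q), ?_⟩
    refine b.repr.injective (Finsupp.ext fun l => ?_)
    have := h (j, l, p, q)
    rw [wedgeForm_apply, ← hs] at this
    simp only [map_add, map_smul, Finsupp.add_apply, Finsupp.smul_apply, smul_eq_mul]
    field_simp
    rw [hx' l q, hx' l p] at this
    linear_combination -this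
  · obtain ⟨t, ht, h'⟩ := Gr.exists_ιMulti_eq_smul_vec (Gr.ofFrame _ hli) hli rfl
    refine ⟨t, funext fun ⟨j, l⟩ => ?_⟩
    rw [Pi.smul_apply, coords, ← map_smul, ← h', minor_ιMulti, hx']
    simp

end Columns

section LineLocus

open MvPolynomial

variable {k : Type*} [Field k] {V : Type*} [AddCommGroup V] [Module k V] [FiniteDimensional k V]
  (hV : Module.finrank k V = 4)

theorem mem_lineLocus_iff {n : ℕ} (b : Module.Basis (Fin n) k V) {R : Gr k 6 (V ⊗[k] V)}
    {Q : Gr k 2 V} :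
    Q ∈ lineLocus hV R ↔ ∃ r ∈ R.1, r ≠ 0 ∧ ∀ j, col b j r ∈ Q.1 := by
  change LinearMap.range (LinearMap.rTensor V Q.1.subtype) ⊓ R.1 ≠ ⊥ ↔ _
  rw [Submodule.ne_bot_iff]
  simp only [Submodule.mem_inf, mem_range_rTensor_iff b]
  grind

/-- The cone over `X_R` is closed in `⋀² V`. -/
theorem exists_eq_smul_coords [Infinite k] {n : ℕ} (b : Module.Basis (Fin n) k V)
    {R : Gr k 6 (V ⊗[k] V)} {x : Fin n × Fin n → k} (hx : x ≠ 0)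
    (h : ∀ p ∈ coneIdeal (fun Q : lineLocus hV R => coords b Q.1) Set.univ, eval x p = 0) :
    ∃ Q : lineLocus hV R, ∃ t : k, x = t • coords b Q.1 := by
  suffices ∃ r ∈ R.1, r ≠ 0 ∧ ∀ a, wedgeForm b a x r = 0 by
    obtain ⟨r, hrR, hr, hrx⟩ := this
    obtain ⟨Q, hQ, t, ht⟩ := exists_coords_eq_of_wedgeForm b hx hr hrx
    exact ⟨⟨Q, (mem_lineLocus_iff hV b).2 ⟨r, hrR, hr, hQ⟩⟩, t, ht⟩
  by_contra! hcon
  -- otherwise the equations in `r ∈ R` expressing `r ∧ x = 0` span the dual of `R`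
  let v (a : Fin n × Fin n × Fin n × Fin n) : (Fin n × Fin n → k) →ₗ[k] Module.Dual k R.1 :=
    (R.1.subtype.dualMap) ∘ₗ wedgeForm b a
  have hspan (y : Fin n × Fin n → k) : Submodule.span k (Set.range fun a => v a y) = ⊤ ↔
      ∀ r ∈ R.1, (∀ a, wedgeForm b a y r = 0) → r = 0 := by
    rw [span_range_dual_eq_top_iff]
    simp [v]
  obtain ⟨F, ⟨m, hm⟩, hF, hF'⟩ := exists_isHomogeneous_span_eq_top v x ((hspan x).2 fun r hr h => by
    by_contra hr0
    obtain ⟨a, ha⟩ := hcon r hr hr0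
    exact ha (h a))
  have hev (y : Fin n × Fin n → k) : eval y (toCoord (Pi.basisFun k _) F) = evalAt y F := by
    rw [← eval_toCoord (Pi.basisFun k _)]
    congr
  refine hF ?_
  rw [← hev]
  refine h _ (mem_coneIdeal_of_isHomogeneous (isHomogeneous_toCoord _ hm) fun Q _ => ?_)
  by_contra hne
  rw [hev] at hne
  obtain ⟨r, hrR, hr, hrQ⟩ := (mem_lineLocus_iff hV b).1 Q.2
  exact hr ((hspan _).1 (hF' _ hne) r hrR fun a => wedgeForm_coords b hrQ a)

/-- `dim X_R < n` iff `X_R` is missed by some linear subspace of codimension `n`. -/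
theorem topologicalKrullDim_lineLocus_lt_iff [IsAlgClosed k] {m : ℕ}
    (b : Module.Basis (Fin m) k V) {R : Gr k 6 (V ⊗[k] V)} (n : ℕ) :
    topologicalKrullDim (lineLocus hV R) < n ↔
      ∃ l : Fin n → Fin m × Fin m → k, ∀ Q ∈ lineLocus hV R, ∃ i, l i ⬝ᵥ coords b Q ≠ 0 := by
  have hinf : Infinite k := IsAlgClosed.instInfinite
  have hc := (isProjCoord_coords b).restrict (lineLocus hV R)
  constructor
  · intro h
    obtain ⟨l, hl⟩ := IsProjCoord.exists_forall_exists_dotProduct_ne_zero n hc h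
    exact ⟨l, fun Q hQ => hl ⟨Q, hQ⟩⟩
  · rintro ⟨l, hl⟩
    exact hc.topologicalKrullDim_lt (fun x hx h => exists_eq_smul_coords hV b hx h) l
      fun Q => hl Q.1 Q.2

end LineLocus

/-! ### Tensors supported on isotropic planes -/

section IsotropicPlanes

open MvPolynomial

variable {k : Type*} [Field k] {V : Type*} [AddCommGroup V] [Module k V] {n : ℕ}
  (b : Module.Basis (Fin n) k V) {ι : Type*}

/-- The alternating bilinear form on `V` given by a linear form in the Plücker coordinates. -/
noncomputable def skewForm (l : Fin n × Fin n → k) : V →ₗ[k] V →ₗ[k] k :=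
  ∑ p, l p • ((b.coord p.1).smulRight (b.coord p.2) - (b.coord p.2).smulRight (b.coord p.1))

theorem skewForm_apply (l : Fin n × Fin n → k) (u v : V) : skewForm b l u v =
    ∑ p, l p * (b.repr u p.1 * b.repr v p.2 - b.repr u p.2 * b.repr v p.1) := by
  simp [skewForm, LinearMap.sum_apply]

theorem isAlt_skewForm (l : Fin n × Fin n → k) : (skewForm b l).IsAlt := fun u => by
  rw [skewForm_apply]
  exact Finset.sum_eq_zero fun p _ => by ring

theorem dotProduct_coords [FiniteDimensional k V] (l : Fin n × Fin n → k) (Q : Gr k 2 V) :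
    l ⬝ᵥ coords b Q = skewForm b l (Q.frame 0) (Q.frame 1) := by
  simp [skewForm_apply, dotProduct, coords_eq]

theorem apply_smul_add_smul {B : V →ₗ[k] V →ₗ[k] k} (hB : B.IsAlt) {u w : V} (h : B u w = 0)
    (s t s' t' : k) : B (s • u + t • w) (s' • u + t' • w) = 0 := by
  have h' : B w u = 0 := by rw [← hB.neg, h, neg_zero]
  simp [h, h', hB u, hB w]

/-- The equations, in the columns of a tensor, of the cone of tensors that lie in `Q ⊗ V` for a
plane `Q` on which all `B i` vanish: the `3 × 3` minors and the values of `B i` on pairs of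
columns. -/
def coneEqs (B : ι → V →ₗ[k] V →ₗ[k] k) : Set (MvPolynomial (Module.Dual k (V ⊗[k] V)) k) :=
  {p | ∃ (f : Fin 3 → Module.Dual k V) (j : Fin 3 → Fin n),
    p = Matrix.det (.of fun a c => X (f c ∘ₗ col b (j a)))} ∪
  {p | ∃ (i : ι) (m m' : Fin n),
    p = ∑ a, X (b.coord a ∘ₗ col b m) * X (B i (b a) ∘ₗ col b m')}

theorem isHomogeneous_of_mem_coneEqs {B : ι → V →ₗ[k] V →ₗ[k] k}
    {p : MvPolynomial (Module.Dual k (V ⊗[k] V)) k} (hp : p ∈ coneEqs b B) :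
    ∃ n, p.IsHomogeneous n := by
  obtain ⟨f, j, rfl⟩ | ⟨i, m, m', rfl⟩ := hp
  · have hX (a c a' c' a'' c'' : Fin 3) : (X (f c ∘ₗ col b (j a)) * X (f c' ∘ₗ col b (j a')) *
        X (f c'' ∘ₗ col b (j a'')) : MvPolynomial (Module.Dual k (V ⊗[k] V)) k).IsHomogeneous 3 :=
      ((isHomogeneous_X k _).mul (isHomogeneous_X k _)).mul (isHomogeneous_X k _)
    refine ⟨3, ?_⟩
    rw [Matrix.det_fin_three]
    simp only [Matrix.of_apply]
    exact ((((((hX _ _ _ _ _ _).sub (hX _ _ _ _ _ _)).sub (hX _ _ _ _ _ _)).add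
      (hX _ _ _ _ _ _)).add (hX _ _ _ _ _ _)).sub (hX _ _ _ _ _ _))
  · exact ⟨2, IsHomogeneous.sum _ _ _ fun a _ => (isHomogeneous_X k _).mul (isHomogeneous_X k _)⟩

theorem evalAt_coneEqs_iff {B : ι → V →ₗ[k] V →ₗ[k] k} (r : V ⊗[k] V) :
    (∀ p ∈ coneEqs b B, evalAt r p = 0) ↔
      (∀ (f : Fin 3 → Module.Dual k V) (j : Fin 3 → Fin n),
        Matrix.det (.of fun a c => f c (col b (j a) r)) = 0) ∧
      ∀ i m m', B i (col b m r) (col b m' r) = 0 := by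
  have h₁ (f : Fin 3 → Module.Dual k V) (j : Fin 3 → Fin n) :
      evalAt r (Matrix.det (.of fun a c => X (f c ∘ₗ col b (j a)))) =
        Matrix.det (.of fun a c => f c (col b (j a) r)) := by
    rw [RingHom.map_det]
    congr 1
    ext a c
    simp [evalAt]
  have h₂ (i : ι) (m m' : Fin n) :
      evalAt r (∑ a, X (b.coord a ∘ₗ col b m) * X (B i (b a) ∘ₗ col b m')) =
        B i (col b m r) (col b m' r) := by
    conv_rhs => rw [← b.sum_repr (col b m r)]
    simp [evalAt, -Module.Basis.sum_repr]
  simp only [coneEqs, Set.mem_union, Set.mem_ofPred_eq, or_imp, forall_and, forall_exists_index]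
  refine and_congr ⟨fun h f j => ?_, ?_⟩ ⟨fun h i m m' => ?_, ?_⟩
  · rw [← h₁]; exact h _ f j rfl
  · rintro h _ f j rfl; rw [h₁]; exact h f j
  · rw [← h₂]; exact h _ i m m' rfl
  · rintro h _ i m m' rfl; rw [h₂]; exact h i m m'

theorem evalAt_coneEqs_of_columns {B : ι → V →ₗ[k] V →ₗ[k] k} (hB : ∀ i, (B i).IsAlt) {u w : V}
    (huw : ∀ i, B i u w = 0) {r : V ⊗[k] V} (hr : ∀ j, ∃ s t : k, col b j r = s • u + t • w) :
    ∀ p ∈ coneEqs b B, evalAt r p = 0 := by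
  rw [evalAt_coneEqs_iff]
  choose s t hst using hr
  refine ⟨fun f j => ?_, fun i m m' => ?_⟩
  · simp only [Matrix.det_fin_three, Matrix.of_apply, hst, map_add, map_smul, smul_eq_mul]
    ring
  · rw [hst, hst, apply_smul_add_smul (hB i) (huw i)]

/-- In dimension four, a nonzero tensor on the cone `coneEqs` lies in `Q ⊗ V` for a plane `Q` on
which all `B i` vanish. If the tensor has rank one, then `Q` is found using that each `B i` imposes
one condition on a second spanning vector. -/
theorem exists_isotropic_plane [FiniteDimensional k V] (hV : Module.finrank k V = 4) [Fintype ι]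
    (hι : Fintype.card ι ≤ 2) {B : ι → V →ₗ[k] V →ₗ[k] k} (hB : ∀ i, (B i).IsAlt) {r : V ⊗[k] V}
    (hr : r ≠ 0) (h : ∀ p ∈ coneEqs b B, evalAt r p = 0) :
    ∃ Q : Gr k 2 V, (∀ j, col b j r ∈ Q.1) ∧ ∀ i, ∀ u ∈ Q.1, ∀ v ∈ Q.1, B i u v = 0 := by
  obtain ⟨hdet, hiso⟩ := (evalAt_coneEqs_iff b r).1 h
  let S : Submodule k V := Submodule.span k (Set.range fun j => col b j r)
  have hcol (j : Fin n) : col b j r ∈ S := Submodule.subset_span ⟨j, rfl⟩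
  have hSiso (i : ι) {u v : V} (hu : u ∈ S) (hv : v ∈ S) : B i u v = 0 := by
    induction hu, hv using Submodule.span_induction₂ with
    | mem_mem x y hx hy =>
      obtain ⟨m, rfl⟩ := hx
      obtain ⟨m', rfl⟩ := hy
      exact hiso i m m'
    | zero_left => simp
    | zero_right => simp
    | add_left x y z _ _ _ hx hy => simp [hx, hy]
    | add_right x y z _ _ _ hx hy => simp [hx, hy]
    | smul_left t x y _ _ hx => simp [hx]
    | smul_right t x y _ _ hx => simp [hx]
  have hpos : 0 < Module.finrank k S := by
    obtain ⟨j, hj⟩ := exists_col_ne_zero b hr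
    exact Module.finrank_pos_iff_exists_ne_zero.2
      ⟨⟨_, hcol j⟩, fun h => hj (congrArg Subtype.val h)⟩
  have hle : Module.finrank k S ≤ 2 := by
    by_contra! hlt
    obtain ⟨κ, a, -, hspan, hli⟩ := exists_linearIndependent' k fun j => col b j r
    have : Fintype κ := FiniteDimensional.fintypeBasisIndex (Module.Basis.span hli)
    have hcard : 3 ≤ Fintype.card κ := by
      rw [← finrank_span_eq_card hli, hspan]
      exact hlt
    let g : Fin 3 → κ := fun i => (Fintype.equivFin κ).symm (Fin.castLE hcard i)
    have hg : Function.Injective g := (Equiv.injective _).comp (Fin.castLE_injective hcard)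
    obtain ⟨f, hf⟩ := exists_dual_family (hli.comp g hg)
    have := hdet f (a ∘ g)
    simp only [Function.comp_apply] at this hf
    simp only [hf] at this
    exact one_ne_zero (Matrix.det_one.symm.trans this)
  obtain ⟨v, w, hli, hS, hvw⟩ : ∃ v w : V, LinearIndependent k ![v, w] ∧
      S ≤ Submodule.span k (Set.range ![v, w]) ∧ ∀ i, B i v w = 0 := by
    obtain h2 | h1 : Module.finrank k S = 2 ∨ Module.finrank k S = 1 := by omega
    · let Q : Gr k 2 V := ⟨S, h2⟩
      have hQ : ![Q.frame 0, Q.frame 1] = Q.frame := by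
        ext i; fin_cases i <;> rfl
      refine ⟨Q.frame 0, Q.frame 1, ?_, ?_, fun i => hSiso i (Q.frame_mem 0) (Q.frame_mem 1)⟩
      · rw [hQ]; exact Q.linearIndependent_frame
      · rw [hQ, Q.span_frame]
    · obtain ⟨⟨v, hvS⟩, hv0, hv⟩ := finrank_eq_one_iff'.1 h1
      let T : Submodule k V := LinearMap.ker (LinearMap.pi fun i => B i v)
      have hT : Module.finrank k S < Module.finrank k T := by
        have h₁ := LinearMap.finrank_range_add_finrank_ker (LinearMap.pi fun i => B i v)
        have h₂ := Submodule.finrank_le (LinearMap.range (LinearMap.pi fun i => B i v))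
        rw [Module.finrank_fintype_fun_eq_card] at h₂
        change _ + Module.finrank k T = _ at h₁
        omega
      obtain ⟨w, hwT, hwS⟩ : ∃ w ∈ T, w ∉ S := by
        by_contra! hcon
        exact absurd (Submodule.finrank_mono hcon) (not_le.2 hT)
      have hv0' : v ≠ 0 := fun h => hv0 (Subtype.ext h)
      refine ⟨v, w, ?_, ?_, fun i => congrFun (LinearMap.mem_ker.1 hwT) i⟩
      · rw [LinearIndependent.pair_iff' hv0']
        intro t ht
        exact hwS (ht ▸ S.smul_mem t hvS)
      · intro x hx
        obtain ⟨t, ht⟩ := hv ⟨x, hx⟩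
        have : t • v = x := congrArg Subtype.val ht
        rw [← this]
        exact Submodule.smul_mem _ _ (Submodule.subset_span ⟨0, rfl⟩)
  refine ⟨Gr.ofFrame _ hli, fun j => hS (hcol j), fun i x hx y hy => ?_⟩
  change x ∈ Submodule.span k _ at hx
  change y ∈ Submodule.span k _ at hy
  rw [Matrix.range_cons, Matrix.range_cons, Matrix.range_empty, Set.union_empty,
    Set.singleton_union, Submodule.mem_span_pair] at hx hy
  obtain ⟨s, t, rfl⟩ := hx
  obtain ⟨s', t', rfl⟩ := hy
  exact apply_smul_add_smul (hB i) (hvw i) _ _ _ _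

/-- The condition that `X_R` meets a linear section of `G(2, V)` of codimension at most two,
in terms of the tensors in `R`. -/
theorem exists_mem_lineLocus_iff [FiniteDimensional k V] (hV : Module.finrank k V = 4) [Fintype ι]
    (hι : Fintype.card ι ≤ 2) (l : ι → Fin n × Fin n → k) (R : Gr k 6 (V ⊗[k] V)) :
    (∃ Q ∈ lineLocus hV R, ∀ i, l i ⬝ᵥ coords b Q = 0) ↔
      ∃ r ∈ R.1, r ≠ 0 ∧ ∀ p ∈ coneEqs b (fun i => skewForm b (l i)), evalAt r p = 0 := by
  constructor
  · rintro ⟨Q, hQ, hl⟩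
    obtain ⟨r, hrR, hr, hrQ⟩ := (mem_lineLocus_iff hV b).1 hQ
    refine ⟨r, hrR, hr, evalAt_coneEqs_of_columns b (fun i => isAlt_skewForm b (l i))
      (u := Q.frame 0) (w := Q.frame 1) (fun i => by rw [← dotProduct_coords, hl]) fun j => ?_⟩
    obtain ⟨s, t, h⟩ := (Q.mem_iff_frame _).1 (hrQ j)
    exact ⟨s, t, h.symm⟩
  · rintro ⟨r, hrR, hr, h⟩
    obtain ⟨Q, hQ, hiso⟩ :=
      exists_isotropic_plane b hV hι (fun i => isAlt_skewForm b (l i)) hr h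
    refine ⟨Q, (mem_lineLocus_iff hV b).2 ⟨r, hrR, hr, hQ⟩, fun i => ?_⟩
    rw [dotProduct_coords]
    exact hiso i _ (Q.frame_mem 0) _ (Q.frame_mem 1)

end IsotropicPlanes

/-! ### Every hyperplane section of `X_R` is nonempty -/

section ParametrizedCones

open MvPolynomial

variable {k : Type*} [Field k]

theorem trdeg_le_of_isIntegral {A : Type*} [CommRing A] [IsDomain A] [Algebra k A] {n : ℕ}
    (f : Fin n → A) (hf : (aeval f : MvPolynomial (Fin n) k →ₐ[k] A).toRingHom.IsIntegral) :
    Algebra.trdeg k A ≤ n := by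
  have halg : Algebra.IsAlgebraic (Algebra.adjoin k (Set.range f)) A := ⟨fun c => by
    obtain ⟨P, hP, hPc⟩ := hf c
    let ρ : MvPolynomial (Fin n) k →ₐ[k] Algebra.adjoin k (Set.range f) :=
      aeval fun i => ⟨f i, Algebra.subset_adjoin ⟨i, rfl⟩⟩
    have hc : IsIntegral (Algebra.adjoin k (Set.range f)) c := by
      refine ⟨P.map (ρ : _ →+* _), hP.map _, ?_⟩
      rw [Polynomial.eval₂_map]
      convert hPc using 2
      refine MvPolynomial.ringHom_ext (fun a => ?_) fun i => ?_
      · simp [ρ]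
      · simp [ρ]
    exact hc.isAlgebraic⟩
  refine (Algebra.IsAlgebraic.trdeg_le_cardinalMk k (Set.range f)).trans ?_
  have := Cardinal.mk_range_le_lift (f := f)
  simpa using this

/-- The projective dimension theorem for the closed cone parametrized by `φ`: if the coordinate ring
of the cone has transcendence degree greater than `n`, then `n` linear forms have a common zero
on the cone outside the origin. -/
theorem exists_ne_zero_of_lt_trdeg [IsAlgClosed k] {σ : Type*} [Fintype σ] {S : Type*} [CommRing S]
    [IsDomain S] [Algebra k S] (φ : MvPolynomial σ k →ₐ[k] S)
    (hφ : ∀ p, φ p = 0 → ∀ n, φ (homogeneousComponent n p) = 0)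
    (halg : Algebra.IsAlgebraic φ.range S) {n : ℕ} (hn : n < Algebra.trdeg k S)
    (l : Fin n → σ → k) :
    ∃ x : σ → k, x ≠ 0 ∧ (∀ p, φ p = 0 → eval x p = 0) ∧ ∀ i, l i ⬝ᵥ x = 0 := by
  by_contra! hcon
  let π : MvPolynomial σ k →ₐ[k] φ.range := φ.rangeRestrict
  have hπ (p : MvPolynomial σ k) : π p = 0 ↔ φ p = 0 := by
    rw [← ZeroMemClass.coe_eq_zero]; rfl
  have hint := isIntegral_comp_aeval_of_forall_eq_zero (π := π.toRingHom)
    φ.rangeRestrict_surjective (fun p hp n => (hπ _).2 (hφ p ((hπ p).1 hp) n))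
    (fun i => linForm (l i)) (fun i => linForm_isHomogeneous (l i)) (by
      intro x hx hlx
      by_contra hx0
      obtain ⟨i, hi⟩ := hcon x hx0 fun p hp => hx p ((hπ p).2 hp)
      exact hi (by rw [← eval_linForm, hlx i]))
  have h₁ : Algebra.trdeg k φ.range ≤ n := by
    refine trdeg_le_of_isIntegral (fun i => π (linForm (l i))) ?_
    convert hint using 1
    refine MvPolynomial.ringHom_ext (fun a => ?_) fun i => ?_
    · simp
    · simp
  have h₂ := trdeg_add_eq (R := k) (S := φ.range) (A := S)
  rw [trdeg_eq_zero (R := φ.range), add_zero] at h₂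
  rw [← h₂] at hn
  exact absurd h₁ (not_le.2 hn)

/-- The parameters of `isotropicParam`. -/
abbrev ParamRing (k : Type*) [Field k] := MvPolynomial (Fin 4 ⊕ Fin 4 ⊕ Fin 3) k

/-- The matrix `u aᵀ + w bᵀ`, where `u = (0, ct, 1, y)` and `w = (1, z, 0, t)` span a plane
isotropic for `e₀* ∧ e₁* + c e₂* ∧ e₃*`, with parameters `a, b, y, z, t`. -/
noncomputable def isotropicParam (c : k) (p : Fin 4 × Fin 4) : ParamRing k :=
  ![0, C c * X (.inr (.inr 2)), 1, X (.inr (.inr 0))] p.1 * X (.inl p.2) +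
  ![1, X (.inr (.inr 1)), 0, X (.inr (.inr 2))] p.1 * X (.inr (.inl p.2))

/-- The entries of `isotropicParam` generate a ring of full transcendence degree: they include the
parameters `a` and `b`, and the other parameters solve linear equations over the entries. -/
theorem isAlgebraic_isotropicParam (c : k) :
    Algebra.IsAlgebraic (aeval (isotropicParam c) : MvPolynomial _ k →ₐ[k] ParamRing k).range
      (ParamRing k) := by
  set A := (aeval (isotropicParam c) : MvPolynomial _ k →ₐ[k] ParamRing k).range
  let N := Subalgebra.algebraicClosure A (ParamRing k)
  have hp (p : Fin 4 × Fin 4) : isotropicParam c p ∈ N :=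
    isAlgebraic_algebraMap (⟨_, ⟨X p, aeval_X _ _⟩⟩ : A)
  have ha (m : Fin 4) : (X (.inl m) : ParamRing k) ∈ N := by
    simpa [isotropicParam] using hp (2, m)
  have hb (m : Fin 4) : (X (.inr (.inl m)) : ParamRing k) ∈ N := by
    simpa [isotropicParam] using hp (0, m)
  let D : ParamRing k := X (.inl 0) * X (.inr (.inl 1)) - X (.inl 1) * X (.inr (.inl 0))
  have hD : D ∈ N := N.sub_mem (N.mul_mem (ha _) (hb _)) (N.mul_mem (ha _) (hb _))
  have hD0 : D ≠ 0 := by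
    intro h
    have := congrArg (eval (Sum.elim (Pi.single 0 1) (Sum.elim (Pi.single 1 1) 0))) h
    simp [D] at this
  -- Cramer's rule in the rows `1` and `3`
  have hdiv {x : ParamRing k} (hx : D * x ∈ N) : x ∈ N :=
    IsAlgebraic.of_mul (mem_nonZeroDivisors_of_ne_zero hD0) hD hx
  have hy : (X (.inr (.inr 0)) : ParamRing k) ∈ N := hdiv <| by
    convert N.sub_mem (N.mul_mem (hp (3, 0)) (hb 1)) (N.mul_mem (hp (3, 1)) (hb 0)) using 1
    simp [isotropicParam, D]; ring
  have hz : (X (.inr (.inr 1)) : ParamRing k) ∈ N := hdiv <| by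
    convert N.sub_mem (N.mul_mem (hp (1, 1)) (ha 0)) (N.mul_mem (hp (1, 0)) (ha 1)) using 1
    simp [isotropicParam, D]; ring
  have ht : (X (.inr (.inr 2)) : ParamRing k) ∈ N := hdiv <| by
    convert N.sub_mem (N.mul_mem (hp (3, 1)) (ha 0)) (N.mul_mem (hp (3, 0)) (ha 1)) using 1
    simp [isotropicParam, D]; ring
  have hX : ∀ i, (X i : ParamRing k) ∈ N := by
    rintro (m | m | m)
    · exact ha m
    · exact hb m
    · fin_cases m
      exacts [hy, hz, ht]
  refine ⟨fun s => ?_⟩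
  change s ∈ N
  induction s using MvPolynomial.induction_on with
  | C a => exact isAlgebraic_algebraMap (algebraMap k A a)
  | add p q hp hq => exact N.add_mem hp hq
  | mul_X p i hp => exact N.mul_mem hp (hX i)

end ParametrizedCones

section ExistenceOfIsotropicPlanes

open MvPolynomial

variable {k : Type*} [Field k] {V : Type*} [AddCommGroup V] [Module k V] [FiniteDimensional k V]

theorem exists_basis_of_isAlt_of_ne_zero (hV : Module.finrank k V = 4) {B : V →ₗ[k] V →ₗ[k] k}
    (hB : B.IsAlt) (hB0 : B ≠ 0) : ∃ e : Module.Basis (Fin 4) k V, B (e 0) (e 1) = 1 ∧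
      B (e 0) (e 2) = 0 ∧ B (e 0) (e 3) = 0 ∧ B (e 1) (e 2) = 0 ∧ B (e 1) (e 3) = 0 := by
  obtain ⟨u, v, huv⟩ : ∃ u v, B u v = 1 := by
    obtain ⟨u, v, h⟩ : ∃ u v, B u v ≠ 0 := by
      by_contra! h
      exact hB0 (LinearMap.ext₂ h)
    exact ⟨(B u v)⁻¹ • u, v, by simp [h]⟩
  have hvu : B v u = -1 := by rw [← hB.neg, huv]
  let g : V →ₗ[k] Fin 2 → k := LinearMap.pi ![B u, B v]
  have hker : 2 ≤ Module.finrank k (LinearMap.ker g) := by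
    have h₁ := LinearMap.finrank_range_add_finrank_ker g
    have h₂ := Submodule.finrank_le (LinearMap.range g)
    rw [Module.finrank_fintype_fun_eq_card, Fintype.card_fin] at h₂
    omega
  obtain ⟨w, hw⟩ := exists_linearIndependent_of_le_finrank hker
  have hu (i : Fin 2) : B u (w i) = 0 := congrFun (LinearMap.mem_ker.1 (w i).2) 0
  have hv (i : Fin 2) : B v (w i) = 0 := congrFun (LinearMap.mem_ker.1 (w i).2) 1
  have hli : LinearIndependent k ![u, v, (w 0 : V), (w 1 : V)] := by
    rw [Fintype.linearIndependent_iff]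
    intro a ha
    simp only [Fin.sum_univ_four, Matrix.cons_val] at ha
    have h0 : a 0 = 0 := by simpa [hv, hvu, hB v] using congrArg (B v) ha
    have h1 : a 1 = 0 := by simpa [hu, huv, hB u] using congrArg (B u) ha
    rw [h0, h1, zero_smul, zero_smul, zero_add, zero_add] at ha
    have := Fintype.linearIndependent_iff.1 hw ![a 2, a 3] (Subtype.ext (by simpa using ha))
    intro i
    fin_cases i
    exacts [h0, h1, this 0, this 1]
  let e := basisOfLinearIndependentOfCardEqFinrank hli (by simp [hV])
  have he : ⇑e = ![u, v, (w 0 : V), (w 1 : V)] := coe_basisOfLinearIndependentOfCardEqFinrank _ _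
  exact ⟨e, by simp [he, huv], by simp [he, hu], by simp [he, hu], by simp [he, hv],
    by simp [he, hv]⟩

/-- A normal form for alternating forms in dimension four. The zero form is replaced by a nonzero
one, so that the normal form always has `B' (e 0) (e 1) = 1`. -/
theorem exists_basis_of_isAlt (hV : Module.finrank k V = 4) {B : V →ₗ[k] V →ₗ[k] k}
    (hB : B.IsAlt) : ∃ (e : Module.Basis (Fin 4) k V) (B' : V →ₗ[k] V →ₗ[k] k), B'.IsAlt ∧
      (∀ u v, B' u v = 0 → B u v = 0) ∧ B' (e 0) (e 1) = 1 ∧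
      B' (e 0) (e 2) = 0 ∧ B' (e 0) (e 3) = 0 ∧ B' (e 1) (e 2) = 0 ∧ B' (e 1) (e 3) = 0 := by
  by_cases hB0 : B = 0
  · let b := Module.finBasisOfFinrankEq k V hV
    let B' := skewForm b (Pi.single (0, 1) 1)
    have hB' : B' ≠ 0 := by
      intro h
      have h1 : B' (b 0) (b 1) = 1 := by
        simp only [B', skewForm_apply]
        rw [Finset.sum_eq_single (0, 1)]
        · simp
        · intro p _ hp; simp [hp]
        · simp
      rw [h] at h1
      exact zero_ne_one h1
    obtain ⟨e, he⟩ := exists_basis_of_isAlt_of_ne_zero hV (isAlt_skewForm b _) hB'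
    exact ⟨e, B', isAlt_skewForm b _, fun u v _ => by simp [hB0], he⟩
  · obtain ⟨e, he⟩ := exists_basis_of_isAlt_of_ne_zero hV hB hB0
    exact ⟨e, B, hB, fun u v h => h, he⟩

/-- Every `X_R` meets every hyperplane section of `G(2, V)`: the cone of tensors in `Q ⊗ V` with
`Q` isotropic has dimension `11`, and `R` is cut out by `10` linear forms. -/
theorem exists_isotropic_mem_lineLocus [IsAlgClosed k] (hV : Module.finrank k V = 4)
    (R : Gr k 6 (V ⊗[k] V)) {B₀ : V →ₗ[k] V →ₗ[k] k} (hB₀ : B₀.IsAlt) :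
    ∃ Q ∈ lineLocus hV R, ∀ u ∈ Q.1, ∀ v ∈ Q.1, B₀ u v = 0 := by
  have hinf : Infinite k := IsAlgClosed.instInfinite
  obtain ⟨e, B, hB, hBB, h01, h02, h03, h12, h13⟩ := exists_basis_of_isAlt hV hB₀
  suffices ∃ r ∈ R.1, r ≠ 0 ∧ ∀ p ∈ coneEqs e (fun _ : Unit => B), evalAt r p = 0 by
    obtain ⟨r, hrR, hr, h⟩ := this
    obtain ⟨Q, hQ, hiso⟩ := exists_isotropic_plane e hV (by simp) (fun _ => hB) hr h
    exact ⟨Q, (mem_lineLocus_iff hV e).2 ⟨r, hrR, hr, hQ⟩,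
      fun u hu v hv => hBB u v (hiso () u hu v hv)⟩
  set c := B (e 2) (e 3) with hc
  let E := e.tensorProduct e
  let φ : MvPolynomial (Fin 4 × Fin 4) k →ₐ[k] ParamRing k := aeval (isotropicParam c)
  -- the matrix with given values of the parameters
  let M (θ : Fin 4 ⊕ Fin 4 ⊕ Fin 3 → k) (p : Fin 4 × Fin 4) : k := eval θ (isotropicParam c p)
  have hM (θ : Fin 4 ⊕ Fin 4 ⊕ Fin 3 → k) (p : MvPolynomial (Fin 4 × Fin 4) k) :
      eval θ (φ p) = eval (M θ) p := by
    simp only [φ, aeval_def, hom_eval₂]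
    rw [eval, coe_eval₂Hom]
    congr 1
    ext a; simp
  have hker (p : MvPolynomial (Fin 4 × Fin 4) k) : φ p = 0 ↔ ∀ θ, eval (M θ) p = 0 := by
    simp only [← hM]
    exact ⟨fun h θ => by rw [h, map_zero], fun h => MvPolynomial.funext fun θ => by
      rw [h, map_zero]⟩
  -- scaling `a` and `b` scales the matrix, so the kernel of `φ` is homogeneous
  have hscale (s : k) (θ : Fin 4 ⊕ Fin 4 ⊕ Fin 3 → k) :
      s • M θ = M (Sum.elim (fun m => s * θ (.inl m))
        (Sum.elim (fun m => s * θ (.inr (.inl m))) fun m => θ (.inr (.inr m)))) := by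
    ext ⟨i, m⟩
    fin_cases i <;> simp [M, isotropicParam] <;> ring
  have hhom (p) (hp : φ p = 0) (n : ℕ) : φ (homogeneousComponent n p) = 0 := by
    rw [hker] at hp ⊢
    intro θ
    exact (forall_eval_smul_eq_zero_iff p (M θ)).1 (fun s => by rw [hscale]; exact hp _) n
  -- ten linear forms defining `R`
  have hquot : Module.finrank k ((V ⊗[k] V) ⧸ R.1) = 10 := by
    have h₁ := R.1.finrank_quotient_add_finrank
    rw [R.2, Module.finrank_tensorProduct, hV] at h₁
    omega
  let g := Module.finBasisOfFinrankEq k _ hquot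
  have hg (r : V ⊗[k] V) : (∀ i, (fun p => g.coord i (R.1.mkQ (E p))) ⬝ᵥ E.repr r = 0) ↔
      r ∈ R.1 := by
    have (i : Fin 10) : (fun p => g.coord i (R.1.mkQ (E p))) ⬝ᵥ E.repr r =
        g.coord i (R.1.mkQ r) := by
      conv_rhs => rw [← E.sum_repr r]
      simp [dotProduct, mul_comm, -Module.Basis.sum_repr]
    simp only [this]
    rw [← Submodule.Quotient.mk_eq_zero, ← Submodule.mkQ_apply, g.forall_coord_eq_zero_iff]
  obtain ⟨x, hx0, hx, hxR⟩ := exists_ne_zero_of_lt_trdeg φ hhom (isAlgebraic_isotropicParam c)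
    (n := 10) (by
      rw [MvPolynomial.trdeg_of_isDomain]
      simp
      norm_num) fun i p => g.coord i (R.1.mkQ (E p))
  obtain ⟨r, rfl⟩ : ∃ r, ⇑(E.repr r) = x := ⟨E.equivFun.symm x, by
    rw [← E.equivFun_apply, LinearEquiv.apply_symm_apply]⟩
  refine ⟨r, (hg r).1 hxR, fun h => hx0 (by simp [h]), fun p hp => ?_⟩
  rw [← eval_toCoord E]
  refine hx _ ((hker _).2 fun θ => ?_)
  obtain ⟨s, hs⟩ : ∃ s, ⇑(E.repr s) = M θ := ⟨E.equivFun.symm (M θ), by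
    rw [← E.equivFun_apply, LinearEquiv.apply_symm_apply]⟩
  rw [← hs, eval_toCoord]
  let y := θ (.inr (.inr 0))
  let z := θ (.inr (.inr 1))
  let t := θ (.inr (.inr 2))
  refine evalAt_coneEqs_of_columns e (fun _ => hB) (u := (c * t) • e 1 + e 2 + y • e 3)
    (w := e 0 + z • e 1 + t • e 3) (fun _ => ?_) (fun m => ?_) p hp
  · have h10 : B (e 1) (e 0) = -1 := by rw [← hB.neg, h01]
    have h20 : B (e 2) (e 0) = 0 := by rw [← hB.neg, h02, neg_zero]
    have h30 : B (e 3) (e 0) = 0 := by rw [← hB.neg, h03, neg_zero]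
    have h21 : B (e 2) (e 1) = 0 := by rw [← hB.neg, h12, neg_zero]
    have h31 : B (e 3) (e 1) = 0 := by rw [← hB.neg, h13, neg_zero]
    simp [h10, h20, h30, h21, h31, h13, hB (e 1), hB (e 3), ← hc]
    ring
  · refine ⟨θ (.inl m), θ (.inr (.inl m)), ?_⟩
    refine e.repr.injective (Finsupp.ext fun i => ?_)
    have hcoord : e.repr (col e m s) i = E.repr s (i, m) := by
      conv_rhs => rw [← sum_col_tmul e s]
      simp [E, Finsupp.single_apply]
    rw [hcoord, hs]
    fin_cases i <;> simp [M, isotropicParam, y, z, t] <;> ring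

end ExistenceOfIsotropicPlanes

/-! ### The locus of `R` with one-dimensional `X_R` -/

section BandTensors

variable {k : Type*} [Field k] {V : Type*} [AddCommGroup V] [Module k V]

/-- The tensors with matrix `(x₀, x₁, x₂, 0), (0, x₀, x₁, x₂)` in the rows `0`, `1` and
`(x₃, x₄, x₅, 0), (0, x₃, x₄, x₅)` in the rows `2`, `3`. -/
noncomputable def bandTensor (b : Module.Basis (Fin 4) k V) : (Fin 6 → k) →ₗ[k] V ⊗[k] V :=
  Fintype.linearCombination k
    ![b 0 ⊗ₜ b 0 + b 1 ⊗ₜ b 1, b 0 ⊗ₜ b 1 + b 1 ⊗ₜ b 2, b 0 ⊗ₜ b 2 + b 1 ⊗ₜ b 3,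
      b 2 ⊗ₜ b 0 + b 3 ⊗ₜ b 1, b 2 ⊗ₜ b 1 + b 3 ⊗ₜ b 2, b 2 ⊗ₜ b 2 + b 3 ⊗ₜ b 3]

theorem repr_col_bandTensor (b : Module.Basis (Fin 4) k V) (x : Fin 6 → k) (i j : Fin 4) :
    b.repr (col b j (bandTensor b x)) i =
      !![x 0, x 1, x 2, 0; 0, x 0, x 1, x 2; x 3, x 4, x 5, 0; 0, x 3, x 4, x 5] i j := by
  rw [bandTensor, Fintype.linearCombination_apply]
  simp only [Fin.sum_univ_six, Matrix.cons_val, map_add, map_smul, col_tmul,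
    Module.Basis.coord_apply, Module.Basis.repr_self, Finsupp.add_apply, Finsupp.smul_apply,
    smul_eq_mul, Finsupp.single_apply]
  fin_cases i <;> fin_cases j <;> simp

/-- If both halves of a band tensor have rank at most one, the tensor vanishes. -/
theorem eq_zero_of_minors {x₀ x₁ x₂ : k} (h₁ : x₀ * x₀ - 0 * x₁ = 0)
    (h₂ : x₁ * x₁ - x₀ * x₂ = 0) (h₃ : x₂ * x₂ - x₁ * 0 = 0) : x₀ = 0 ∧ x₁ = 0 ∧ x₂ = 0 := by
  obtain rfl : x₀ = 0 := by simpa using h₁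
  obtain rfl : x₂ = 0 := by simpa using h₃
  exact ⟨rfl, by simpa using h₂, rfl⟩

end BandTensors

section GenericDimension

variable {k : Type*} [Field k] {V : Type*} [AddCommGroup V] [Module k V] [FiniteDimensional k V]
  (hV : Module.finrank k V = 4)

/-- As no hyperplane misses `X_R`, its dimension is `1` iff a linear section of codimension two
misses it. -/
theorem mem_dimOneLocus_iff [IsAlgClosed k] {m : ℕ} (b : Module.Basis (Fin m) k V)
    (R : Gr k 6 (V ⊗[k] V)) : R ∈ dimOneLocus hV ↔
      ∃ l : Fin 2 → Fin m × Fin m → k, ¬ ∃ Q ∈ lineLocus hV R, ∀ i, l i ⬝ᵥ coords b Q = 0 := by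
  have hlow : ¬ topologicalKrullDim (lineLocus hV R) < (1 : ℕ) := by
    rw [topologicalKrullDim_lineLocus_lt_iff hV b]
    rintro ⟨l, hl⟩
    obtain ⟨Q, hQ, hiso⟩ := exists_isotropic_mem_lineLocus hV R (isAlt_skewForm b (l 0))
    obtain ⟨i, hi⟩ := hl Q hQ
    rw [Subsingleton.elim i 0, dotProduct_coords] at hi
    exact hi (hiso _ (Q.frame_mem 0) _ (Q.frame_mem 1))
  have hupp := topologicalKrullDim_lineLocus_lt_iff hV b (R := R) 2
  push Not
  rw [← hupp]
  change topologicalKrullDim (lineLocus hV R) = 1 ↔ _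
  revert hlow
  generalize topologicalKrullDim (lineLocus hV R) = d
  intro hlow
  constructor
  · rintro rfl
    exact_mod_cast Nat.one_lt_two
  · intro h
    induction d using WithBot.recBotCoe with
    | bot => exact absurd (WithBot.bot_lt_coe _) hlow
    | coe e =>
      have h2 : e < ((2 : ℕ) : ℕ∞) := WithBot.coe_lt_coe.1 h
      lift e to ℕ using (h2.trans_le le_top).ne
      have h1 : ¬ e < 1 := by exact_mod_cast hlow
      have h2 : e < 2 := Nat.cast_lt.1 h2
      obtain rfl : e = 1 := by omega
      rfl

theorem isOpen_dimOneLocus [IsAlgClosed k] : IsOpen (dimOneLocus (k := k) (V := V) hV) := by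
  let b := Module.finBasisOfFinrankEq k V hV
  have : dimOneLocus (k := k) (V := V) hV = ⋃ l : Fin 2 → Fin 4 × Fin 4 → k,
      {R | ∃ r ∈ R.1, r ≠ 0 ∧ ∀ p ∈ coneEqs b (fun i => skewForm b (l i)), evalAt r p = 0}ᶜ := by
    ext R
    rw [mem_dimOneLocus_iff hV b, Set.mem_iUnion]
    refine exists_congr fun l => ?_
    rw [exists_mem_lineLocus_iff b hV (by simp)]
    rfl
  rw [this]
  exact isOpen_iUnion fun l => (isClosed_setOf_exists_mem_cone _
    fun p hp => isHomogeneous_of_mem_coneEqs b hp).isOpen_compl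

/-- For the space `R` of band tensors, `X_R` does not meet the quadric surface of planes that meet
both `⟨b 0, b 1⟩` and `⟨b 2, b 3⟩` nontrivially: on this surface the minors of `Q` in the rows
`2`, `3` and in the rows `0`, `1` vanish, hence so do those of the tensors in `Q ⊗ V`. -/
theorem nonempty_dimOneLocus [IsAlgClosed k] : (dimOneLocus (k := k) (V := V) hV).Nonempty := by
  let b := Module.finBasisOfFinrankEq k V hV
  have hinj : Function.Injective (bandTensor b) := by
    rw [← LinearMap.ker_eq_bot, LinearMap.ker_eq_bot']
    intro x hx
    have h (i j : Fin 4) := repr_col_bandTensor b x i j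
    simp only [hx, map_zero, Finsupp.zero_apply] at h
    ext i
    fin_cases i
    exacts [(h 0 0).symm, (h 0 1).symm, (h 0 2).symm, (h 2 0).symm, (h 2 1).symm, (h 2 2).symm]
  let R : Gr k 6 (V ⊗[k] V) := ⟨LinearMap.range (bandTensor b), by
    rw [LinearMap.finrank_range_of_inj hinj, Module.finrank_fintype_fun_eq_card, Fintype.card_fin]⟩
  refine ⟨R, (mem_dimOneLocus_iff hV b R).2 ⟨![Pi.single (0, 1) 1, Pi.single (2, 3) 1], ?_⟩⟩
  rintro ⟨Q, hQ, hl⟩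
  obtain ⟨r, ⟨x, rfl⟩, hr, hrQ⟩ := (mem_lineLocus_iff hV b).1 hQ
  have h01 : coords b Q (0, 1) = 0 := by simpa using hl 0
  have h23 : coords b Q (2, 3) = 0 := by simpa using hl 1
  -- by the Cauchy–Binet formula, the minors of `r` in two rows are multiples of that of `Q`
  have hminor {i j : Fin 4} (h : coords b Q (i, j) = 0) (m m' : Fin 4) :
      b.repr (col b m (bandTensor b x)) i * b.repr (col b m' (bandTensor b x)) j -
        b.repr (col b m (bandTensor b x)) j * b.repr (col b m' (bandTensor b x)) i = 0 := by
    obtain ⟨s, t, hst⟩ := (Q.mem_iff_frame _).1 (hrQ m)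
    obtain ⟨s', t', hst'⟩ := (Q.mem_iff_frame _).1 (hrQ m')
    rw [coords_eq] at h
    rw [← hst, ← hst']
    simp only [map_add, map_smul, Finsupp.add_apply, Finsupp.smul_apply, smul_eq_mul]
    linear_combination (s * t' - t * s') * h
  simp only [repr_col_bandTensor] at hminor
  obtain ⟨h0, h1, h2⟩ := eq_zero_of_minors (hminor h01 0 1) (hminor h01 1 2) (hminor h01 2 3)
  obtain ⟨h3, h4, h5⟩ := eq_zero_of_minors (hminor h23 0 1) (hminor h23 1 2) (hminor h23 2 3)
  refine hr ?_
  have : x = 0 := by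
    ext i
    fin_cases i
    exacts [h0, h1, h2, h3, h4, h5]
  rw [this, map_zero]

end GenericDimension

end LineLocus

theorem mainTheorem2 {k : Type*} [Field k] [IsAlgClosed k] {V : Type*} [AddCommGroup V]
    [Module k V] [FiniteDimensional k V] (hV : Module.finrank k V = 4) :
    IsOpen (LineLocus.dimOneLocus (k := k) (V := V) hV) ∧
      Dense (LineLocus.dimOneLocus (k := k) (V := V) hV) := by
  have : Infinite k := IsAlgClosed.instInfinite
  have hopen := LineLocus.isOpen_dimOneLocus (k := k) (V := V) hV
  exact ⟨hopen, hopen.dense (LineLocus.nonempty_dimOneLocus hV)⟩
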